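/- Let $d\ge 1$, and identify functions on $[0,1]^d$ with their extensions to $\mathbf R^d$ that are 1-periodic in each coordinate. Put $\phi_0=1$ and $\phi_j(t)=\sqrt2\cos(2\pi jt)$ for $j\ge1$. For $k=1,\dots,d$ let $s_k>0$, $q_k\ge0$, $L_k>0$, let $a_{k0}\in(0,\infty]$ (where $a_{k0}=\infty$ means that the coefficient $\theta_0$ is required to be $0$, that is, $\int f_k=0$), let $C_0j^{s_k}\le a_{kj}\le C_1j^{s_k}$ for $j\ge1$ with constants $C_0,C_1>0$, and let $$\mathcal F_k=\Big\{\sum_{j\ge0}\theta_j\phi_j:\ \sum_{j\ge0}a_{kj}^2\theta_j^2\le L_k^2\Big\}\subset L_2([0,1]),\qquad \mathcal F=\Big\{x\mapsto\sum_{k=1}^d f_k(x_k):\ f_k\in\mathcal F_k\Big\}\subset L_2([0,1]^d).$$ Let $Af(x)=\int_{[0,1]^d}a(x-y)f(y)\,dy$, where $a$ is integrable on $[0,1]^d$ and 1-periodic in each coordinate, and suppose that the marginals $a_k(t)=\int a(y_1,\dots,y_{k-1},t,y_{k+1},\dots,y_d)\prod_{l\ne k}dy_l$ lie in $L_2([0,1])$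 and have expansions $a_k=\sum_{j\ge0}b_{kj}\phi_j$ with $b_{k0}>0$ and $C_2j^{-q_k}\le b_{kj}\le C_3j^{-q_k}$ for $j\ge1$, for constants $C_2,C_3>0$. One observes the white noise model $dY_n(y)=(Af)(y)\,dy+n^{-1/2}dW(y)$ on $[0,1]^d$, i.e. all the integrals $\int h\,dY_n=\int (Af)h+n^{-1/2}\int h\,dW$, $h\in L_2([0,1]^d)$, with $W$ Gaussian white noise; an estimator is a measurable function of the observation with values in $L_2([0,1]^d)$. Let $$a^*=\min_{k=1,\dots,d}\frac{2s_k}{2s_k+2q_k+1}.$$ (i) (Upper bound.) For each $k$ there are finite $\delta$-nets $\mathcal F_{k,\delta}\subset\mathcal F_k$ of $\mathcal F_k$ in the $L_2$-norm ($\delta>0$) such that, for a constant $C$ not depending on $\delta$, $\log\#\mathcal F_{k,\delta}\le C\delta^{-1/s_k}$ and every element of $\mathcal F_{k,\delta}$ has zero coefficient at $\phi_j$ for all $j>C\delta^{-1/s_k}$. For all such families of nets and all $\delta_{k,n}$ with $cn^{-s_k/(2s_k+2q_k+1)}\le\delta_{k,n}\le C'n^{-s_k/(2s_k+2q_k+1)}$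 for all $k$ and all $n\ge1$ ($c,C'>0$ constants), the $\delta$-net estimator, i.e. a measurable minimizer $\hat f$ of the empirical risk $$\gamma_n(g)=-2\int (Qg)\,dY_n+\|g\|_2^2$$ over the net $\{\sum_kg_k(x_k):g_k\in\mathcal F_{k,\delta_{k,n}}\}$ of $\mathcal F$, exists for every $n\ge1$, and any sequence of such minimizers satisfies $$\limsup_{n\to\infty}n^{a^*}\sup_{f\in\mathcal F}E_f\|\hat f-f\|_2^2<\infty .$$ Here $Q=(A^{-1})^*$ is the adjoint of the inverse of $A$ on the space of square integrable additive functions: $Qg$ is additive and $\int fg=\int(Af)(Qg)$ for all square integrable additive $f$. (ii) (Lower bound.) $$\liminf_{n\to\infty}n^{a^*}\inf_{\hat g}\sup_{f\in\mathcal F}E_f\|\hat g-f\|_2^2>0,$$ where the infimum is taken over all estimators $\hat g$ in the white noise model. -/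

import Mathlib

open MeasureTheory ProbabilityTheory Filter Topology
open scoped ENNReal

noncomputable section

namespace AdditiveInverse

/-- Real `L²([0,1])`, a square integrable function on `[0,1]` being identified with its
1-periodic extension, i.e. with a function on the circle `ℝ/ℤ` (Lebesgue measure, total mass 1). -/
abbrev L2One : Type := Lp ℝ 2 (volume : Measure UnitAddCircle)

/-- Real `L²([0,1]^d)`, again with 1-periodic extension, i.e. `L²` of the torus `(ℝ/ℤ)^d`. -/
abbrev L2Torus (d : ℕ) : Type := Lp ℝ 2 (volume : Measure (UnitAddTorus (Fin d)))

/-- The basis functions `φ₀ = 1`, `φ_j(t) = √2 cos(2πjt)` for `j ≥ 1`, on the circle. -/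
def phi (j : ℕ) : C(UnitAddCircle, ℝ) where
  toFun t := if j = 0 then 1 else √2 * (fourier (j : ℤ) t).re
  continuous_toFun := by
    by_cases h : j = 0
    · simpa [h] using continuous_const
    · simp only [h, if_false]
      fun_prop

theorem phi_zero_apply (t : UnitAddCircle) : phi 0 t = 1 := by
  simp [phi]

theorem phi_coe (j : ℕ) (hj : j ≠ 0) (t : ℝ) :
    phi j (t : UnitAddCircle) = √2 * Real.cos (2 * Real.pi * j * t) := by
  have h : (2 * Real.pi * Complex.I * ((j : ℤ) : ℂ) * (t : ℂ) / ((1 : ℝ) : ℂ) : ℂ)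
      = ((2 * Real.pi * j * t : ℝ) : ℂ) * Complex.I := by
    push_cast
    ring
  change (if j = 0 then 1 else √2 * (fourier (j : ℤ) (t : AddCircle (1 : ℝ))).re) = _
  rw [if_neg hj, fourier_coe_apply, h, Complex.exp_ofReal_mul_I_re]

/-- `φ_j` as an element of `L²([0,1])`. -/
def phiLp (j : ℕ) : L2One := ContinuousMap.toLp 2 volume ℝ (phi j)

/-- The function class `{∑_j θ_j φ_j : ∑_j w_j² θ_j² ≤ L²}` of an ellipsoid with semi-axis weights
`w_j ∈ [0,∞]`; a weight `∞` forces `θ_j = 0` (as `∞ * 0 = 0` and `∞ * x = ∞` for `x > 0`). -/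
def ellipsoidClass (w : ℕ → ℝ≥0∞) (L : ℝ) : Set L2One :=
  {f | ∃ θ : ℕ → ℝ, ∑' j, (w j) ^ 2 * ENNReal.ofReal (θ j ^ 2) ≤ ENNReal.ofReal (L ^ 2) ∧
    HasSum (fun j => θ j • phiLp j) f}

instance instIsProbabilityMeasureCircle :
    IsProbabilityMeasure (volume : Measure UnitAddCircle) :=
  ⟨UnitAddCircle.measure_univ⟩

/-- The function `x ↦ g(x_k)` on the torus, for `g ∈ L²([0,1])`. -/
def lift {d : ℕ} (k : Fin d) (g : L2One) : L2Torus d :=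
  Lp.compMeasurePreserving (fun x : UnitAddTorus (Fin d) => x k)
    (measurePreserving_eval (fun _ : Fin d => (volume : Measure UnitAddCircle)) k) g

/-- The additive class `S₁ ⊕ ⋯ ⊕ S_d` of all functions `x ↦ f₁(x₁) + ⋯ + f_d(x_d)` with
`f_k ∈ S_k`. -/
def additiveClass {d : ℕ} (S : Fin d → Set L2One) : Set (L2Torus d) :=
  {f | ∃ g : Fin d → L2One, (∀ k, g k ∈ S k) ∧ f = ∑ k, lift k (g k)}

/-- The space of all square integrable additive functions. -/
def additiveSpace (d : ℕ) : Set (L2Torus d) := additiveClass fun _ => Set.univ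

/-- The operator `A`: `(Af)(x) = ∫ a(x - y) f(y) dy`. -/
def conv {d : ℕ} (a : UnitAddTorus (Fin d) → ℝ) (f : UnitAddTorus (Fin d) → ℝ)
    (x : UnitAddTorus (Fin d)) : ℝ :=
  ∫ y, a (x - y) * f y

/-- The `k`th marginal `a_k(t) = ∫ a(y₁, …, y_{k-1}, t, y_{k+1}, …, y_d) ∏_{l ≠ k} dy_l` of `a`.
(The integrand does not depend on `y k`, over which we integrate a measure of mass one.) -/
def marginal {d : ℕ} (a : UnitAddTorus (Fin d) → ℝ) (k : Fin d) (t : UnitAddCircle) : ℝ :=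
  ∫ y : UnitAddTorus (Fin d), a (Function.update y k t)

/-- `q` is the value at `g` of the adjoint of the inverse of `A`, where `A` is considered on
the space of additive functions: `∫ f g = ∫ (Af) q` for all additive `f`, that is,
`∫ (A⁻¹h) g = ∫ h q` for all `h = Af`. -/
def IsAdjointInverseAt {d : ℕ} (a : UnitAddTorus (Fin d) → ℝ) (g q : L2Torus d) : Prop :=
  q ∈ additiveSpace d ∧
    ∀ f ∈ additiveSpace d, ∫ x, f x * g x = ∫ x, conv a f x * q x

open Classical in
/-- The operator `Q = (A⁻¹)*` (with value `0` outside its domain of definition). -/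
def Q {d : ℕ} (a : UnitAddTorus (Fin d) → ℝ) (g : L2Torus d) : L2Torus d :=
  if h : ∃ q, IsAdjointInverseAt a g q then h.choose else 0

/-- `W` is the white noise `h ↦ ∫ h dW` on `[0,1]^d`: for all `h₁, h₂ ∈ L²` the vector
`(∫ h₁ dW, ∫ h₂ dW)` is Gaussian with mean zero and covariance `∫ h₁ h₂` (hence with variances
`‖h₁‖²`, `‖h₂‖²`). -/
structure IsWhiteNoise {d : ℕ} {Ω : Type*} [MeasurableSpace Ω] (P : Measure Ω)
    (W : L2Torus d → Ω → ℝ) : Prop where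
  measurable : ∀ h, Measurable (W h)
  gaussian : ∀ h₁ h₂, HasGaussianLaw (fun ω => (W h₁ ω, W h₂ ω)) P
  mean_zero : ∀ h, ∫ ω, W h ω ∂P = 0
  covariance : ∀ h₁ h₂, ∫ ω, W h₁ ω * W h₂ ω ∂P = inner ℝ h₁ h₂

/-- The observation `dY_n = (Af)(y) dy + n^{-1/2} dW(y)`, given through all the integrals
`∫ h dY_n = ∫ (Af) h + n^{-1/2} ∫ h dW`, `h ∈ L²`. -/
def observation {d : ℕ} {Ω : Type*} (a : UnitAddTorus (Fin d) → ℝ) (W : L2Torus d → Ω → ℝ)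
    (n : ℕ) (f : L2Torus d) (ω : Ω) : L2Torus d → ℝ :=
  fun h => (∫ x, conv a f x * h x) + (√(n : ℝ))⁻¹ * W h ω

/-- An estimator is a measurable function of the observation with values in `L²([0,1]^d)`. -/
def IsEstimator {d : ℕ} (ghat : (L2Torus d → ℝ) → L2Torus d) : Prop :=
  Measurable[MeasurableSpace.pi, borel (L2Torus d)] ghat

/-- The mean integrated squared error `E_f ‖ĝ - f‖²` at noise level `n^{-1/2}`. -/
def mise {d : ℕ} {Ω : Type*} [MeasurableSpace Ω] (P : Measure Ω)
    (a : UnitAddTorus (Fin d) → ℝ) (W : L2Torus d → Ω → ℝ) (n : ℕ)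
    (ghat : (L2Torus d → ℝ) → L2Torus d) (f : L2Torus d) : ℝ≥0∞ :=
  ∫⁻ ω, ENNReal.ofReal (‖ghat (observation a W n f ω) - f‖ ^ 2) ∂P

/-- The `L²` empirical risk `γ_n(g) = -2 ∫ (Qg) dY_n + ‖g‖²`. -/
def empiricalRisk {d : ℕ} (a : UnitAddTorus (Fin d) → ℝ) (y : L2Torus d → ℝ)
    (g : L2Torus d) : ℝ :=
  -2 * y (Q a g) + ‖g‖ ^ 2

/-- `fhat` minimizes the empirical risk over the set `S`. -/
def IsMinimizerOver {d : ℕ} (a : UnitAddTorus (Fin d) → ℝ) (S : Set (L2Torus d))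
    (fhat : (L2Torus d → ℝ) → L2Torus d) : Prop :=
  IsEstimator fhat ∧
    ∀ y, fhat y ∈ S ∧ ∀ φ ∈ S, empiricalRisk a y (fhat y) ≤ empiricalRisk a y φ

/-- `N δ`, `δ > 0`, are finite `δ`-nets of the class `F ⊆ L²([0,1])`, consisting of elements of `F`,
such that, for a constant `C`, all coefficients with index `j > C δ^{-1/s}` of the elements of
`N δ` vanish, and `log #(N δ) ≤ C δ^{-1/s}`. -/
def IsNetFamily (s : ℝ) (F : Set L2One) (N : ℝ → Set L2One) : Prop :=
  ∃ C > 0, ∀ δ > 0,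
    (N δ).Finite ∧ N δ ⊆ F ∧ (∀ f ∈ F, ∃ φ ∈ N δ, ‖f - φ‖ ≤ δ) ∧
    (∀ φ ∈ N δ, ∀ j : ℕ, C * δ ^ (-1 / s) < j → inner ℝ (phiLp j) φ = 0) ∧
    Real.log ((N δ).ncard) ≤ C * δ ^ (-1 / s)

end AdditiveInverse

end

/-!
The argument rests on one orthonormal system: the constant function together with the functions
`x ↦ φ_j(x_k)`, `j ≥ 1` (`addBasis`). Convolution with `a` acts on an additive function through the
marginals of `a`, and these are cosine series, so that `A` is diagonal in this system (and in the
corresponding sines) with eigenvalues `b_{kj} / √2`, and `b_{k0}` on constants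
(`integral_conv_mul_lift`, `conv_lift_phi`, `conv_lift_psi`). As the real trigonometric system is complete, `Q` is well
defined on finite combinations of the basis functions and divides the coefficients by the eigenvalues (`Q_sum`).

*Upper bound.* No maximal inequality over the net is needed. All elements of the net lie in the
span of the basis functions of frequency `j ≲ δ_k^{-1/s_k}`. There `γ_n` differs from
`g ↦ ‖g - f‖² - ‖f‖²` by `-2 n^{-1/2} W(Qg)`, and on this span the linear functional `g ↦ W(Qg)` has
the norm `√Z`, where `Z = ∑ (W(e_i) / λ_i)²` and the `λ_i` are the eigenvalues. Comparing the
minimizer with the best approximation `g₀` of `f` gives `‖f̂ - f‖² ≤ 4 ‖g₀ - f‖² + 6 Z / n`, and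
`E Z = ∑ λ_i⁻²` is of order `∑_k δ_k^{-(2 q_k + 1) / s_k}` (`mise_le`). The choice of `δ_k` balances
this variance against the bias `δ_k²`.

*Existence of nets.* Truncating at frequency `J ≍ δ^{-1/s}` costs `δ / 2`. The truncated
coefficients are rounded to a grid of width `≍ δ / √J`; by the Cauchy–Schwarz inequality the
resulting integer vectors `m` satisfy `∑ (j / J)^s |m_j| ≲ J`, and the exponential Markov inequality
bounds the number of such vectors by `exp(C J)`, because `J^J / J! ≤ e^J` (`ncard_lattice_le`,
`prod_ratio_le`, `exists_isNetFamily`).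

*Lower bound.* For the coordinate `k` with the smallest exponent, put a hypercube of functions
`∑_{J < j ≤ 2J} ± τ φ_j(x_k)` with `J ≍ n^{1/(2s+2q+1)}` and `τ ≍ J^{-s-1/2}` into the class. Since
white noise is a Gaussian process, its component along a basis function is independent of the noise
in the orthogonal complement; changing a sign only replaces the mean `μ` of this one normal variable by
`-μ`, where `μ` is at most its standard deviation, so the two laws of the observation have a common component of fixed
mass (`IsWhiteNoise.lintegral_shift_ge`). Hence no estimator recovers the sign, and summing over the
frequencies (`assouad_bound`) yields a risk of order `J τ² ≍ J^{-2s}`.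
-/

noncomputable section

namespace AdditiveInverse

/-! ### White noise -/

section WhiteNoise

variable {d : ℕ} {Ω : Type*} [MeasurableSpace Ω] {P : Measure Ω} {W : L2Torus d → Ω → ℝ}

namespace IsWhiteNoise

lemma hasGaussianLaw (hW : IsWhiteNoise P W) (h : L2Torus d) : HasGaussianLaw (W h) P :=
  (hW.gaussian h h).fst

lemma memLp_two (hW : IsWhiteNoise P W) (h : L2Torus d) : MemLp (W h) 2 P :=
  (hW.hasGaussianLaw h).memLp_two

lemma integrable_mul (hW : IsWhiteNoise P W) (g h : L2Torus d) :
    Integrable (fun ω => W g ω * W h ω) P :=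
  (hW.memLp_two g).integrable_mul (hW.memLp_two h)

/-- White noise is almost surely linear: the second moment of the defect vanishes. -/
lemma ae_add_smul (hW : IsWhiteNoise P W) (g h : L2Torus d) (c : ℝ) :
    W (g + c • h) =ᵐ[P] fun ω => W g ω + c * W h ω := by
  set k := g + c • h with hk
  have hmem : MemLp (fun ω => W k ω - (W g ω + c * W h ω)) 2 P :=
    (hW.memLp_two k).sub ((hW.memLp_two g).add ((hW.memLp_two h).const_mul c))
  have hzero : ∫ ω, (W k ω - (W g ω + c * W h ω)) ^ 2 ∂P = 0 := by
    have e : (fun ω => (W k ω - (W g ω + c * W h ω)) ^ 2) = fun ω =>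
        W k ω * W k ω + W g ω * W g ω + c ^ 2 * (W h ω * W h ω) - 2 * (W k ω * W g ω)
          - 2 * c * (W k ω * W h ω) + 2 * c * (W g ω * W h ω) := by
      ext ω; ring
    have i1 := hW.integrable_mul k k
    have i2 := hW.integrable_mul g g
    have i3 := (hW.integrable_mul h h).const_mul (c ^ 2)
    have i4 := (hW.integrable_mul k g).const_mul 2
    have i5 := (hW.integrable_mul k h).const_mul (2 * c)
    have i6 := (hW.integrable_mul g h).const_mul (2 * c)
    have j2 : Integrable (fun ω => W k ω * W k ω + W g ω * W g ω) P := i1.add i2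
    have j3 : Integrable (fun ω => W k ω * W k ω + W g ω * W g ω + c ^ 2 * (W h ω * W h ω)) P :=
      j2.add i3
    have j4 : Integrable (fun ω => W k ω * W k ω + W g ω * W g ω + c ^ 2 * (W h ω * W h ω)
        - 2 * (W k ω * W g ω)) P := j3.sub i4
    have j5 : Integrable (fun ω => W k ω * W k ω + W g ω * W g ω + c ^ 2 * (W h ω * W h ω)
        - 2 * (W k ω * W g ω) - 2 * c * (W k ω * W h ω)) P := j4.sub i5
    rw [e, integral_add j5 i6, integral_sub j4 i5, integral_sub j3 i4, integral_add j2 i3,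
      integral_add i1 i2]
    simp only [integral_const_mul, hW.covariance]
    simp only [hk, inner_add_left, inner_add_right, inner_smul_left, inner_smul_right,
      real_inner_comm h g]
    simp
    ring
  have := (integral_eq_zero_iff_of_nonneg (fun ω => sq_nonneg _) hmem.integrable_sq).1 hzero
  filter_upwards [this] with ω hω
  have : W k ω - (W g ω + c * W h ω) = 0 := by simpa using hω
  linarith

lemma ae_sum_smul (hW : IsWhiteNoise P W) {ι : Type*} (s : Finset ι) (c : ι → ℝ)
    (h : ι → L2Torus d) :
    W (∑ i ∈ s, c i • h i) =ᵐ[P] fun ω => ∑ i ∈ s, c i * W (h i) ω := by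
  classical
  induction s using Finset.induction_on with
  | empty =>
    have := hW.ae_add_smul 0 0 (-1)
    filter_upwards [this] with ω hω
    simp at hω ⊢
    linarith
  | insert i s hi ih =>
    rw [Finset.sum_insert hi, add_comm]
    filter_upwards [hW.ae_add_smul (∑ i ∈ s, c i • h i) (h i) (c i), ih] with ω h1 h2
    rw [h1, h2, Finset.sum_insert hi, add_comm]

/-- White noise is a Gaussian process: by linearity a linear combination of finitely many of its
values is one of its values, whence Gaussian. -/
lemma isGaussianProcess (hW : IsWhiteNoise P W) : IsGaussianProcess W P where
  hasGaussianLaw I := by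
    classical
    have hm : Measurable fun ω => I.restrict (W · ω) :=
      measurable_pi_lambda _ fun i => hW.measurable i
    refine ⟨⟨fun L => ?_⟩⟩
    have hL : L ∘ (fun ω => I.restrict (W · ω)) =ᵐ[P]
        W (∑ i : I, L (Pi.single i 1) • (i : L2Torus d)) := by
      filter_upwards [hW.ae_sum_smul Finset.univ (fun i : I => L (Pi.single i 1))
        (fun i => (i : L2Torus d))] with ω hω
      rw [hω, Function.comp_apply, ← L.sum_comp_single]
      refine Finset.sum_congr rfl fun i _ => ?_
      have : (Pi.single i (I.restrict (W · ω) i) : I → ℝ) =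
          W i ω • (Pi.single i (1 : ℝ) : I → ℝ) := by
        ext j
        simp [Pi.single_apply]
      rw [ContinuousLinearMap.comp_apply, ContinuousLinearMap.single_apply, this, map_smul,
        smul_eq_mul, mul_comm]
    have hg : HasGaussianLaw (L ∘ fun ω => I.restrict (W · ω)) P :=
      (hW.hasGaussianLaw _).congr hL.symm
    rw [Measure.map_map L.continuous.measurable hm, hg.map_eq_gaussianReal,
      integral_map hm.aemeasurable L.continuous.aestronglyMeasurable,
      variance_map L.continuous.aemeasurable hm.aemeasurable]
    rfl

variable [IsProbabilityMeasure P]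

lemma cov_eq_inner (hW : IsWhiteNoise P W) (g h : L2Torus d) : cov[W g, W h; P] = inner ℝ g h := by
  rw [covariance_eq_sub (hW.memLp_two g) (hW.memLp_two h), hW.mean_zero, hW.mean_zero]
  simpa using hW.covariance g h

/-- For a unit vector `e` the noise in direction `e` is standard normal. -/
lemma map_unit (hW : IsWhiteNoise P W) {e : L2Torus d} (he : ‖e‖ = 1) :
    P.map (W e) = gaussianReal 0 1 := by
  have hv : Var[W e; P] = 1 := by
    rw [← covariance_self (hW.measurable e).aemeasurable, hW.cov_eq_inner,
      real_inner_self_eq_norm_sq, he, one_pow]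
  rw [(hW.hasGaussianLaw e).map_eq_gaussianReal, hW.mean_zero, hv]
  simp

/-- The noise in direction `e` is independent of the noise projected onto the orthogonal
complement of `e`. -/
lemma indepFun_proj (hW : IsWhiteNoise P W) {e : L2Torus d} (he : ‖e‖ = 1) :
    IndepFun (W e) (fun ω (h : L2Torus d) => W h ω - inner ℝ e h * W e ω) P := by
  classical
  let Y : L2Torus d → Ω → ℝ := fun h ω => W h ω - inner ℝ e h * W e ω
  have hG : IsGaussianProcess (Sum.elim (fun _ : Unit => W e) Y) P := by
    refine hW.isGaussianProcess.of_isGaussianProcess fun s => ?_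
    rcases s with u | h
    · exact ⟨{e}, ContinuousLinearMap.proj ⟨e, by simp⟩, fun ω => rfl⟩
    · exact ⟨{h, e}, ContinuousLinearMap.proj ⟨h, by simp⟩ -
        (inner ℝ e h : ℝ) • ContinuousLinearMap.proj ⟨e, by simp⟩, fun ω => rfl⟩
  have hind := hG.indepFun_of_covariance_eq_zero (fun _ => (hW.measurable e).aemeasurable)
    (fun h => ((hW.measurable h).sub ((hW.measurable e).const_mul _)).aemeasurable)
    (fun _ h => by
      have : Y h = W h - fun ω => inner ℝ e h * W e ω := rfl
      rw [this, covariance_sub_right (hW.memLp_two e) (hW.memLp_two h)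
        ((hW.memLp_two e).const_mul _), covariance_const_mul_right, hW.cov_eq_inner,
        hW.cov_eq_inner, real_inner_self_eq_norm_sq, he]
      ring)
  exact hind.comp (φ := fun x : Unit → ℝ => x ()) (ψ := id) (measurable_pi_apply ()) measurable_id

end IsWhiteNoise

end WhiteNoise

/-! ### Two-point bounds -/

/-- Normal laws with mean in `[-1,1]` have a common component: each dominates a fixed multiple of
`N(0,1/2)`. -/
lemma smul_gaussianReal_le {m : ℝ} (hm : |m| ≤ 1) :
    ENNReal.ofReal (Real.exp (-1) / √2) • gaussianReal 0 (1 / 2) ≤ gaussianReal m 1 := by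
  rw [gaussianReal_of_var_ne_zero _ (by simp), gaussianReal_of_var_ne_zero _ (by simp),
    ← withDensity_smul _ (measurable_gaussianPDF _ _)]
  refine withDensity_mono (ae_of_all _ fun x => ?_)
  rw [Pi.smul_apply, smul_eq_mul, gaussianPDF, gaussianPDF,
    ← ENNReal.ofReal_mul (by positivity)]
  refine ENNReal.ofReal_le_ofReal ?_
  rw [gaussianPDFReal, gaussianPDFReal]
  have h1 : (√(2 * Real.pi * ((1 / 2 : NNReal) : ℝ)))⁻¹ =
      √2 * (√(2 * Real.pi * ((1 : NNReal) : ℝ)))⁻¹ := by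
    have : 2 * Real.pi * ((1 / 2 : NNReal) : ℝ) = (2 * Real.pi * ((1 : NNReal) : ℝ)) / 2 := by
      push_cast; ring
    rw [this, Real.sqrt_div (by positivity), inv_div, div_eq_mul_inv]
  rw [h1]
  have h2 : Real.exp (-1) / √2 * (√2 * (√(2 * Real.pi * ((1 : NNReal) : ℝ)))⁻¹ *
      Real.exp (-(x - 0) ^ 2 / (2 * ((1 / 2 : NNReal) : ℝ)))) =
      (√(2 * Real.pi * ((1 : NNReal) : ℝ)))⁻¹ * Real.exp (-1 - x ^ 2) := by
    have : -(x - 0) ^ 2 / (2 * ((1 / 2 : NNReal) : ℝ)) = -x ^ 2 := by push_cast; ring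
    rw [this, sub_eq_add_neg, Real.exp_add]
    field_simp
  rw [h2]
  refine mul_le_mul_of_nonneg_left (Real.exp_le_exp.2 ?_) (by positivity)
  have hm2 : m ^ 2 ≤ 1 := by
    rw [← sq_abs]; exact pow_le_one₀ (abs_nonneg m) hm
  -- `(x - m)² ≤ 2 x² + 2 m² ≤ 2 x² + 2`
  push_cast
  nlinarith [sq_nonneg (x + m)]

section TwoPoint

variable {d : ℕ} {Ω : Type*} [MeasurableSpace Ω] {P : Measure Ω} [IsProbabilityMeasure P]
  {W : L2Torus d → Ω → ℝ}

/-- Shifting the observation in a direction `e` by at most one noise standard deviation leaves a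
component of its law which does not depend on the shift. -/
lemma IsWhiteNoise.lintegral_shift_ge (hW : IsWhiteNoise P W) {e : L2Torus d} (he : ‖e‖ = 1)
    (m : L2Torus d → ℝ) {σ μ : ℝ} (hσ : 0 < σ) (hμ : |μ| ≤ σ)
    {G : (L2Torus d → ℝ) → ℝ≥0∞} (hG : Measurable G) :
    ENNReal.ofReal (Real.exp (-1) / √2) * ∫⁻ p : ℝ × (L2Torus d → ℝ),
        G (fun h => m h + σ * (inner ℝ e h * p.1 + p.2 h))
          ∂((gaussianReal 0 (1 / 2)).prod
            (P.map fun ω (h : L2Torus d) => W h ω - inner ℝ e h * W e ω))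
      ≤ ∫⁻ ω, G (fun h => m h + μ * inner ℝ e h + σ * W h ω) ∂P := by
  set Y : Ω → L2Torus d → ℝ := fun ω h => W h ω - inner ℝ e h * W e ω with hY
  have hYm : Measurable Y := measurable_pi_lambda _ fun h =>
    (hW.measurable h).sub ((hW.measurable e).const_mul _)
  have : IsProbabilityMeasure (P.map Y) := Measure.isProbabilityMeasure_map hYm.aemeasurable
  have hT : Measurable fun p : ℝ × (L2Torus d → ℝ) =>
      (fun h => m h + σ * (inner ℝ e h * p.1 + p.2 h) : L2Torus d → ℝ) := by
    refine measurable_pi_lambda _ fun h => ?_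
    have : Measurable fun p : ℝ × (L2Torus d → ℝ) => p.2 h :=
      (measurable_pi_apply h).comp measurable_snd
    fun_prop
  have hGT := hG.comp hT
  -- the noise along `e` and the orthogonal noise have a product law
  have hprod : P.map (fun ω => (W e ω, Y ω)) = (gaussianReal 0 1).prod (P.map Y) := by
    rw [(indepFun_iff_map_prod_eq_prod_map_map (hW.measurable e).aemeasurable
      hYm.aemeasurable).1 (hW.indepFun_proj he), hW.map_unit he]
  have hR : ∫⁻ ω, G (fun h => m h + μ * inner ℝ e h + σ * W h ω) ∂P =
      ∫⁻ p, G (fun h => m h + σ * (inner ℝ e h * p.1 + p.2 h))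
        ∂((gaussianReal (μ / σ) 1).prod (P.map Y)) := by
    have h1 : (gaussianReal (μ / σ) 1).prod (P.map Y) =
        ((gaussianReal 0 1).prod (P.map Y)).map (Prod.map (· + μ / σ) id) := by
      rw [← Measure.map_prod_map _ _ (by fun_prop) measurable_id, Measure.map_id,
        gaussianReal_map_add_const, zero_add]
    have hsh : Measurable (Prod.map (· + μ / σ) id :
        ℝ × (L2Torus d → ℝ) → ℝ × (L2Torus d → ℝ)) := by fun_prop
    simp only [Function.comp_def] at hGT
    have hGS := hGT.comp hsh
    simp only [Function.comp_def] at hGS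
    rw [h1, lintegral_map hGT hsh, ← hprod, lintegral_map hGS ((hW.measurable e).prodMk hYm)]
    refine lintegral_congr fun ω => ?_
    congr 1
    ext h
    simp only [hY, Prod.map, id]
    field_simp
    ring
  -- only the normal variable along `e` feels the shift, and it dominates the common component
  rw [hR, ← smul_eq_mul, ← lintegral_smul_measure, ← Measure.prod_smul_left]
  refine lintegral_mono' ?_ le_rfl
  refine Measure.prod_mono (smul_gaussianReal_le ?_) le_rfl
  rw [abs_div, abs_of_pos hσ]
  exact (div_le_one hσ).2 hμ

/-- Le Cam's two-point bound for estimating `±τ` when the signal is shifted by `±μ` in the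
direction `e`, with `μ` at most the noise level. -/
lemma IsWhiteNoise.two_point (hW : IsWhiteNoise P W) {e : L2Torus d} (he : ‖e‖ = 1)
    (m : L2Torus d → ℝ) {σ μ : ℝ} (hσ : 0 < σ) (hμ : |μ| ≤ σ) (τ : ℝ)
    {T : (L2Torus d → ℝ) → ℝ} (hT : Measurable T) :
    ENNReal.ofReal (Real.exp (-1) / √2) * ENNReal.ofReal (2 * τ ^ 2) ≤
      ∫⁻ ω, ENNReal.ofReal ((T (fun h => m h + μ * inner ℝ e h + σ * W h ω) - τ) ^ 2) ∂P +
      ∫⁻ ω, ENNReal.ofReal ((T (fun h => m h + -μ * inner ℝ e h + σ * W h ω) + τ) ^ 2) ∂P := by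
  have h1 := hW.lintegral_shift_ge he m hσ hμ
    (G := fun y => ENNReal.ofReal ((T y - τ) ^ 2)) (by fun_prop)
  have h2 := hW.lintegral_shift_ge he m hσ (μ := -μ) (by rwa [abs_neg])
    (G := fun y => ENNReal.ofReal ((T y + τ) ^ 2)) (by fun_prop)
  refine le_trans ?_ (add_le_add h1 h2)
  rw [← mul_add]
  gcongr
  set Y : Ω → L2Torus d → ℝ := fun ω h => W h ω - inner ℝ e h * W e ω with hY
  have hYm : Measurable Y := measurable_pi_lambda _ fun h =>
    (hW.measurable h).sub ((hW.measurable e).const_mul _)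
  have : IsProbabilityMeasure (P.map Y) := Measure.isProbabilityMeasure_map hYm.aemeasurable
  have hS : Measurable fun p : ℝ × (L2Torus d → ℝ) =>
      (fun h => m h + σ * (inner ℝ e h * p.1 + p.2 h) : L2Torus d → ℝ) := by
    refine measurable_pi_lambda _ fun h => ?_
    have : Measurable fun p : ℝ × (L2Torus d → ℝ) => p.2 h :=
      (measurable_pi_apply h).comp measurable_snd
    fun_prop
  have hTS := hT.comp hS
  simp only [Function.comp_def] at hTS
  rw [← lintegral_add_left (by fun_prop)]
  calc ENNReal.ofReal (2 * τ ^ 2) = ∫⁻ _ : ℝ × (L2Torus d → ℝ), ENNReal.ofReal (2 * τ ^ 2)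
        ∂((gaussianReal 0 (1 / 2)).prod (P.map Y)) := by simp
    _ ≤ _ := by
        refine lintegral_mono fun p => ?_
        rw [← ENNReal.ofReal_add (sq_nonneg _) (sq_nonneg _)]
        refine ENNReal.ofReal_le_ofReal ?_
        nlinarith [sq_nonneg (T (fun h => m h + σ * (inner ℝ e h * p.1 + p.2 h)))]

end TwoPoint

/-! ### The trigonometric system on the circle -/

section


/-- The sine functions `√2 sin(2πjt)`, which together with the `phi j` form a complete system. -/
def psi (j : ℕ) : C(UnitAddCircle, ℝ) where
  toFun t := √2 * (fourier (j : ℤ) t).im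
  continuous_toFun := by fun_prop

/-- `√2 sin(2πjt)` as an element of `L²([0,1])`. -/
def psiLp (j : ℕ) : L2One := ContinuousMap.toLp 2 volume ℝ (psi j)

lemma phi_apply {j : ℕ} (hj : j ≠ 0) (t : UnitAddCircle) :
    phi j t = √2 * (fourier (j : ℤ) t).re := by
  simp [phi, hj]

lemma psi_apply (j : ℕ) (t : UnitAddCircle) : psi j t = √2 * (fourier (j : ℤ) t).im := rfl

lemma volume_circle_eq_haar :
    (volume : Measure UnitAddCircle) = AddCircle.haarAddCircle := by
  rw [AddCircle.volume_eq_smul_haarAddCircle]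
  simp

lemma integral_fourier (n : ℤ) : ∫ t : UnitAddCircle, fourier n t = if n = 0 then 1 else 0 := by
  have h := congrFun (fourierCoeff_fourier (T := 1) n) 0
  rw [fourierCoeff, ← volume_circle_eq_haar] at h
  simp only [neg_zero, fourier_zero, one_smul] at h
  rw [h, Pi.single_apply]
  simp [eq_comm]

lemma integrable_continuous (f : C(UnitAddCircle, ℝ)) : Integrable f :=
  f.continuous.integrable_of_hasCompactSupport (HasCompactSupport.of_compactSpace _)

lemma integrable_fourier (n : ℤ) : Integrable (fun t : UnitAddCircle => fourier n t) :=
  (fourier n).continuous.integrable_of_hasCompactSupport (HasCompactSupport.of_compactSpace _)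

lemma integral_fourier_re (n : ℤ) :
    ∫ t : UnitAddCircle, (fourier n t).re = if n = 0 then 1 else 0 := by
  have := integral_re (𝕜 := ℂ) (integrable_fourier n)
  simp only [RCLike.re_eq_complex_re] at this
  rw [this, integral_fourier]
  split_ifs <;> simp

lemma integral_fourier_im (n : ℤ) : ∫ t : UnitAddCircle, (fourier n t).im = 0 := by
  have := integral_im (𝕜 := ℂ) (integrable_fourier n)
  simp only [RCLike.im_eq_complex_im] at this
  rw [this, integral_fourier]
  split_ifs <;> simp

lemma integrable_fourier_re (n : ℤ) : Integrable (fun t : UnitAddCircle => (fourier n t).re) :=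
  (integrable_fourier n).re

lemma integrable_fourier_im (n : ℤ) : Integrable (fun t : UnitAddCircle => (fourier n t).im) :=
  (integrable_fourier n).im

lemma integral_phi_mul_phi (i j : ℕ) :
    ∫ t, phi i t * phi j t = if i = j then 1 else 0 := by
  rcases eq_or_ne i 0 with rfl | hi
  · rcases eq_or_ne j 0 with rfl | hj
    · simp [phi_zero_apply]
    · simp only [phi_zero_apply, phi_apply hj, one_mul, integral_const_mul, integral_fourier_re]
      simp [hj, hj.symm]
  · rcases eq_or_ne j 0 with rfl | hj
    · simp only [phi_zero_apply, phi_apply hi, mul_one, integral_const_mul, integral_fourier_re]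
      simp [hi]
    · have h : ∀ t : UnitAddCircle, phi i t * phi j t =
          (fourier ((i : ℤ) + j) t).re + (fourier ((i : ℤ) + -j) t).re := fun t => by
        rw [phi_apply hi, phi_apply hj, fourier_add, fourier_add, fourier_neg]
        simp only [Complex.mul_re, Complex.conj_re, Complex.conj_im]
        have : √2 * √2 = 2 := Real.mul_self_sqrt (by norm_num)
        linear_combination ((fourier (i : ℤ) t).re * (fourier (j : ℤ) t).re) * this
      simp only [h]
      rw [integral_add (integrable_fourier_re _) (integrable_fourier_re _), integral_fourier_re,
        integral_fourier_re, if_neg (by omega), zero_add]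
      congr 1
      simp only [eq_iff_iff]
      omega

lemma integral_phi_mul_psi (i j : ℕ) : ∫ t, phi i t * psi j t = 0 := by
  rcases eq_or_ne i 0 with rfl | hi
  · simp only [phi_zero_apply, psi_apply, one_mul, integral_const_mul, integral_fourier_im,
      mul_zero]
  · have h : ∀ t : UnitAddCircle, phi i t * psi j t =
        (fourier ((j : ℤ) + i) t).im + (fourier ((j : ℤ) + -i) t).im := fun t => by
      rw [phi_apply hi, psi_apply, fourier_add, fourier_add, fourier_neg]
      simp only [Complex.mul_im, Complex.conj_re, Complex.conj_im]
      have : √2 * √2 = 2 := Real.mul_self_sqrt (by norm_num)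
      linear_combination ((fourier (i : ℤ) t).re * (fourier (j : ℤ) t).im) * this
    simp only [h]
    rw [integral_add (integrable_fourier_im _) (integrable_fourier_im _), integral_fourier_im,
      integral_fourier_im, add_zero]

lemma coeFn_toLp (u : C(UnitAddCircle, ℝ)) :
    (ContinuousMap.toLp 2 volume ℝ u : L2One) =ᵐ[volume] u :=
  ContinuousMap.coeFn_toLp _ _

lemma inner_toLp (u : C(UnitAddCircle, ℝ)) (g : L2One) :
    inner ℝ (ContinuousMap.toLp 2 volume ℝ u : L2One) g = ∫ t, u t * g t := by
  rw [L2.inner_def]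
  refine integral_congr_ae ?_
  filter_upwards [coeFn_toLp u] with t ht
  rw [ht]
  simp [mul_comm]

lemma inner_toLp_toLp (u v : C(UnitAddCircle, ℝ)) :
    inner ℝ (ContinuousMap.toLp 2 volume ℝ u : L2One) (ContinuousMap.toLp 2 volume ℝ v : L2One) =
      ∫ t, u t * v t := by
  rw [inner_toLp]
  refine integral_congr_ae ?_
  filter_upwards [coeFn_toLp v] with t ht
  rw [ht]

lemma orthonormal_phiLp : Orthonormal ℝ phiLp := by
  classical
  rw [orthonormal_iff_ite]
  intro i j
  rw [phiLp, phiLp, inner_toLp_toLp, integral_phi_mul_phi]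

lemma inner_phiLp_psiLp (i j : ℕ) : inner ℝ (phiLp i) (psiLp j) = 0 := by
  rw [phiLp, psiLp, inner_toLp_toLp, integral_phi_mul_psi]

/-- Completeness of the real trigonometric system. -/
lemma eq_zero_of_inner_trig_eq_zero {g : L2One} (h1 : ∀ j, inner ℝ (phiLp j) g = 0)
    (h2 : ∀ j, inner ℝ (psiLp j) g = 0) : g = 0 := by
  have hg : MemLp (fun t => ((g t : ℝ) : ℂ)) 2 (AddCircle.haarAddCircle (T := 1)) := by
    rw [← volume_circle_eq_haar]
    exact (Lp.memLp g).ofReal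
  have hgi : Integrable g := (Lp.memLp g).integrable (by norm_num)
  -- the complex Fourier coefficients of nonnegative frequency
  have hcoe : ∀ n : ℕ, ∫ t, fourier (n : ℤ) t * ((g t : ℝ) : ℂ) = 0 := fun n => by
    have hint : Integrable (fun t : UnitAddCircle => fourier (n : ℤ) t * ((g t : ℝ) : ℂ)) :=
      hgi.ofReal.bdd_mul (fourier (n : ℤ)).continuous.aestronglyMeasurable
        (c := 1) (ae_of_all _ fun t =>
          ((fourier (n : ℤ)).norm_coe_le_norm t).trans (fourier_norm _).le)
    have hre : ∫ t, (fourier (n : ℤ) t).re * g t = 0 := by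
      rcases eq_or_ne n 0 with rfl | hn
      · have := h1 0
        rw [phiLp, inner_toLp] at this
        simpa [phi_zero_apply] using this
      · have := h1 n
        rw [phiLp, inner_toLp] at this
        simp only [phi_apply hn, mul_assoc, integral_const_mul] at this
        simpa using this
    have him : ∫ t, (fourier (n : ℤ) t).im * g t = 0 := by
      have := h2 n
      rw [psiLp, inner_toLp] at this
      simp only [psi_apply, mul_assoc, integral_const_mul] at this
      simpa using this
    apply Complex.ext
    · have := integral_re (𝕜 := ℂ) hint
      simp only [RCLike.re_eq_complex_re, Complex.re_mul_ofReal] at this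
      rw [← this, hre]; rfl
    · have := integral_im (𝕜 := ℂ) hint
      simp only [RCLike.im_eq_complex_im, Complex.im_mul_ofReal] at this
      rw [← this, him]; rfl
  have hcoe' : ∀ n : ℤ, ∫ t, fourier n t * ((g t : ℝ) : ℂ) = 0 := fun n => by
    obtain ⟨m, rfl | rfl⟩ := n.eq_nat_or_neg
    · exact hcoe m
    · have := congrArg (starRingEnd ℂ) (hcoe m)
      rw [← integral_conj] at this
      simp only [map_mul, Complex.conj_ofReal, map_zero] at this
      simpa only [fourier_neg] using this
  have hzero : hg.toLp = 0 := by
    rw [← (fourierBasis (T := 1)).repr.map_eq_zero_iff]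
    ext n
    rw [fourierBasis_repr, fourierCoeff_congr_ae hg.coeFn_toLp, fourierCoeff,
      ← volume_circle_eq_haar]
    simpa using hcoe' (-n)
  have hae := (Lp.eq_zero_iff_ae_eq_zero.1 hzero).symm.trans hg.coeFn_toLp
  rw [← volume_circle_eq_haar] at hae
  rw [Lp.eq_zero_iff_ae_eq_zero]
  filter_upwards [hae] with t ht
  simpa using ht.symm

/-! ### Functions of one coordinate on the torus -/

variable {d : ℕ}

/-- Replacing the `k`th coordinate of a uniform point of the torus by an independent uniform
variable gives a uniform point. -/
lemma measurePreserving_update (k : Fin d) :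
    MeasurePreserving (fun p : UnitAddCircle × UnitAddTorus (Fin d) => Function.update p.2 k p.1)
      (volume.prod volume) volume := by
  have hm : Measurable
      (fun p : UnitAddCircle × UnitAddTorus (Fin d) => Function.update p.2 k p.1) := by
    refine measurable_pi_lambda _ fun i => ?_
    rcases eq_or_ne i k with rfl | h
    · simpa using measurable_fst
    · have : Measurable fun p : UnitAddCircle × UnitAddTorus (Fin d) => p.2 i :=
        (measurable_pi_apply i).comp measurable_snd
      simpa [h] using this
  refine ⟨hm, ?_⟩
  rw [volume_pi]
  refine (Measure.pi_eq fun s hs => ?_).symm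
  have hpre : (fun p : UnitAddCircle × UnitAddTorus (Fin d) => Function.update p.2 k p.1) ⁻¹'
      Set.univ.pi s = s k ×ˢ Set.univ.pi (Function.update s k Set.univ) := by
    ext p
    simp only [Set.mem_preimage, Set.mem_pi, Set.mem_univ, true_imp_iff, Set.mem_prod]
    constructor
    · intro h
      refine ⟨by simpa using h k, fun i => ?_⟩
      rcases eq_or_ne i k with rfl | hi
      · simp
      · simpa [hi] using h i
    · rintro ⟨h1, h2⟩ i
      rcases eq_or_ne i k with rfl | hi
      · simpa using h1
      · simpa [hi] using h2 i
  rw [Measure.map_apply hm (MeasurableSet.univ_pi hs), hpre, Measure.prod_prod, Measure.pi_pi,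
    ← Finset.mul_prod_erase _ _ (Finset.mem_univ k),
    ← Finset.mul_prod_erase _ (fun i => volume (s i)) (Finset.mem_univ k)]
  simp only [Function.update_self, measure_univ, one_mul]
  congr 1
  refine Finset.prod_congr rfl fun i hi => ?_
  rw [Function.update_of_ne (Finset.ne_of_mem_erase hi)]

/-- Fubini's theorem in the form used in the definition of `marginal`: the integrand of the inner
integral does not depend on the `k`th coordinate of `y`. -/
lemma integral_eq_integral_update (k : Fin d) {F : UnitAddTorus (Fin d) → ℝ}
    (hF : Integrable F) :
    ∫ x, F x = ∫ t, ∫ y : UnitAddTorus (Fin d), F (Function.update y k t) := by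
  have h := measurePreserving_update k
  have hm : ∫ x, F x = ∫ p : UnitAddCircle × UnitAddTorus (Fin d),
      F (Function.update p.2 k p.1) ∂(volume.prod volume) := by
    conv_lhs => rw [← h.map_eq]
    rw [integral_map h.measurable.aemeasurable (h.map_eq.symm ▸ hF.aestronglyMeasurable)]
  rw [hm, integral_prod]
  exact h.integrable_comp_of_integrable hF

/-- `lift` as a linear isometry. -/
def liftₗᵢ (k : Fin d) : L2One →ₗᵢ[ℝ] L2Torus d :=
  Lp.compMeasurePreservingₗᵢ ℝ (fun x : UnitAddTorus (Fin d) => x k)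
    (measurePreserving_eval (fun _ : Fin d => (volume : Measure UnitAddCircle)) k)

lemma liftₗᵢ_apply (k : Fin d) (g : L2One) : liftₗᵢ k g = lift k g := rfl

lemma coeFn_lift (k : Fin d) (g : L2One) : lift k g =ᵐ[volume] fun x => g (x k) :=
  Lp.coeFn_compMeasurePreserving _ _

lemma coeFn_lift_toLp (k : Fin d) (u : C(UnitAddCircle, ℝ)) :
    lift k (ContinuousMap.toLp 2 volume ℝ u) =ᵐ[volume] fun x => u (x k) :=
  (coeFn_lift k _).trans
    ((measurePreserving_eval (fun _ : Fin d => (volume : Measure UnitAddCircle)) k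
      ).quasiMeasurePreserving.ae_eq_comp (coeFn_toLp u))

lemma inner_lift_lift_self (k : Fin d) (g h : L2One) :
    inner ℝ (lift k g) (lift k h) = inner ℝ g h := (liftₗᵢ k).inner_map_map g h

/-- The constant functions are lifts from every coordinate. -/
lemma lift_phiLp_zero (k l : Fin d) : lift k (phiLp 0) = lift l (phiLp 0) := by
  refine Lp.ext ?_
  filter_upwards [coeFn_lift_toLp k (phi 0), coeFn_lift_toLp l (phi 0)] with x h1 h2
  rw [phiLp, h1, h2, phi_zero_apply, phi_zero_apply]

lemma inner_lift_toLp (k : Fin d) (u : C(UnitAddCircle, ℝ)) (f : L2Torus d) :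
    inner ℝ (lift k (ContinuousMap.toLp 2 volume ℝ u)) f = ∫ x, u (x k) * f x := by
  rw [L2.inner_def]
  refine integral_congr_ae ?_
  filter_upwards [coeFn_lift_toLp k u] with t ht
  simp [ht, mul_comm]

lemma integrable_bdd_mul (k : Fin d) (u : C(UnitAddCircle, ℝ)) {f : UnitAddTorus (Fin d) → ℝ}
    (hf : Integrable f) : Integrable fun x => u (x k) * f x :=
  hf.bdd_mul (u.continuous.comp (continuous_apply k)).aestronglyMeasurable
    (c := ‖u‖) (ae_of_all _ fun _ => u.norm_coe_le_norm _)

lemma integrable_L2 (f : L2Torus d) : Integrable f := (Lp.memLp f).integrable (by norm_num)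

lemma inner_lift_toLp_of_ne {k l : Fin d} (hkl : k ≠ l) (u v : C(UnitAddCircle, ℝ)) :
    inner ℝ (lift k (ContinuousMap.toLp 2 volume ℝ u)) (lift l (ContinuousMap.toLp 2 volume ℝ v)) =
      (∫ t, u t) * ∫ t, v t := by
  rw [inner_lift_toLp]
  have h1 : ∫ x, u (x k) * (lift l (ContinuousMap.toLp 2 volume ℝ v) : L2Torus d) x =
      ∫ x : UnitAddTorus (Fin d), u (x k) * v (x l) := by
    refine integral_congr_ae ?_
    filter_upwards [coeFn_lift_toLp l v] with x hx
    rw [hx]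
  have hint : Integrable fun x : UnitAddTorus (Fin d) => v (x l) :=
    (measurePreserving_eval (fun _ : Fin d => (volume : Measure UnitAddCircle)) l
      ).integrable_comp_of_integrable (integrable_continuous v)
  rw [h1, integral_eq_integral_update k (integrable_bdd_mul k u hint)]
  simp only [Function.update_self, Function.update_of_ne hkl.symm, integral_const_mul,
    integral_mul_const]
  congr 1
  have := (measurePreserving_eval (fun _ : Fin d => (volume : Measure UnitAddCircle)) l).map_eq
  conv_rhs => rw [← this]
  rw [integral_map (measurable_pi_apply l).aemeasurable v.continuous.aestronglyMeasurable]
  rfl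

lemma integral_phi {j : ℕ} (hj : j ≠ 0) : ∫ t, phi j t = 0 := by
  have := integral_phi_mul_phi j 0
  simpa [phi_zero_apply, hj] using this

/-- The orthonormal basis of the even additive functions: the constant `1` and the functions
`x ↦ φ_{j+1}(x_k)`. The coordinate `k₀` only serves to produce the constant. -/
def addBasis (k₀ : Fin d) : Option (Fin d × ℕ) → L2Torus d
  | none => lift k₀ (phiLp 0)
  | some (k, j) => lift k (phiLp (j + 1))

lemma orthonormal_addBasis (k₀ : Fin d) : Orthonormal ℝ (addBasis k₀) := by
  classical
  rw [orthonormal_iff_ite]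
  have hself : ∀ k : Fin d, ∀ i j : ℕ, inner ℝ (lift k (phiLp i)) (lift k (phiLp j)) =
      if i = j then (1 : ℝ) else 0 := fun k i j => by
    rw [inner_lift_lift_self, orthonormal_iff_ite.1 orthonormal_phiLp]
  rintro (_ | ⟨k, i⟩) (_ | ⟨l, j⟩)
  · simpa only [addBasis, if_true] using hself k₀ 0 0
  · simp only [addBasis, lift_phiLp_zero k₀ l, hself]
    simp
  · simp only [addBasis, lift_phiLp_zero k₀ k, hself]
    simp
  · simp only [addBasis]
    rcases eq_or_ne k l with rfl | hkl
    · rw [hself]; simp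
    · rw [phiLp, phiLp, inner_lift_toLp_of_ne hkl, integral_phi (by omega)]
      simp [hkl]

end

section

variable {d : ℕ}

/-! ### The convolution operator on additive functions -/

/-- The eigenvalues of the convolution with `∑ j, b j • φ_j` on the trigonometric system:
`φ_j * φ_j = φ_j / √2` for `j ≥ 1`. -/
def eig (b : ℕ → ℝ) (j : ℕ) : ℝ := if j = 0 then b 0 else b j / √2

lemma integral_marginal_mul {a : UnitAddTorus (Fin d) → ℝ} (ha : Integrable a) (k : Fin d)
    (u : C(UnitAddCircle, ℝ)) :
    ∫ z, u (z k) * a z = ∫ t, u t * marginal a k t := by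
  rw [integral_eq_integral_update k (integrable_bdd_mul k u ha)]
  simp only [Function.update_self, integral_const_mul, marginal]

lemma fourier_add_apply (n : ℤ) (s t : UnitAddCircle) :
    fourier n (s + t) = fourier n s * fourier n t := by
  simp only [fourier_apply, smul_add, AddCircle.toCircle_add, Circle.coe_mul]

lemma fourier_sub_apply (n : ℤ) (s t : UnitAddCircle) :
    fourier n (s - t) = fourier n s * starRingEnd ℂ (fourier n t) := by
  rw [sub_eq_add_neg, fourier_add_apply, ← fourier_neg]
  simp only [fourier_apply, smul_neg, neg_smul]

section Marginal

variable {a : UnitAddTorus (Fin d) → ℝ} {k : Fin d} (hak : MemLp (marginal a k) 2) {b : ℕ → ℝ}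
  (hb : HasSum (fun j => b j • phiLp j) hak.toLp)

include hb

lemma integral_phi_mul_marginal (j : ℕ) : ∫ t, phi j t * marginal a k t = b j := by
  have h1 : inner ℝ (phiLp j) hak.toLp = b j := by
    have := (hb.mapL (innerSL ℝ (phiLp j))).unique
      (hasSum_single j fun i hi => by
        simp [orthonormal_phiLp.2 hi.symm])
    simpa [inner_smul_right, orthonormal_phiLp.1 j] using this
  rw [← h1, phiLp, inner_toLp]
  refine integral_congr_ae ?_
  filter_upwards [hak.coeFn_toLp] with t ht
  rw [ht]

lemma integral_psi_mul_marginal (j : ℕ) : ∫ t, psi j t * marginal a k t = 0 := by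
  have h1 : inner ℝ (psiLp j) hak.toLp = (0 : ℝ) := by
    have h := hb.mapL (innerSL ℝ (psiLp j))
    simp only [map_smul, innerSL_apply_apply, real_inner_comm, inner_phiLp_psiLp, smul_zero] at h
    exact h.unique hasSum_zero
  rw [← h1, psiLp, inner_toLp]
  refine integral_congr_ae ?_
  filter_upwards [hak.coeFn_toLp] with t ht
  rw [ht]

/-- The marginal is an even function, so that the sine is integrated to zero. -/
lemma integral_trig_mul_marginal (j : ℕ) (α β : ℝ) :
    ∫ t, (α * phi j t + β * psi j t) * marginal a k t = α * b j := by
  have hi : ∀ u : C(UnitAddCircle, ℝ), Integrable fun t => u t * marginal a k t := fun u =>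
    (hak.integrable (by norm_num)).bdd_mul u.continuous.aestronglyMeasurable
      (c := ‖u‖) (ae_of_all _ fun _ => u.norm_coe_le_norm _)
  simp only [add_mul, mul_assoc]
  rw [integral_add ((hi _).const_mul α) ((hi _).const_mul β), integral_const_mul,
    integral_const_mul, integral_phi_mul_marginal hak hb, integral_psi_mul_marginal hak hb]
  ring

lemma integral_phi_sub_mul_marginal (j : ℕ) (s : UnitAddCircle) :
    ∫ t, phi j (s - t) * marginal a k t = eig b j * phi j s := by
  rcases eq_or_ne j 0 with rfl | hj
  · simpa [phi_zero_apply, eig] using integral_phi_mul_marginal hak hb 0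
  · have := integral_trig_mul_marginal hak hb j (fourier (j : ℤ) s).re (fourier (j : ℤ) s).im
    rw [eig, if_neg hj, phi_apply hj]
    have h2 : ∀ t, phi j (s - t) = (fourier (j : ℤ) s).re * phi j t +
        (fourier (j : ℤ) s).im * psi j t := fun t => by
      rw [phi_apply hj, phi_apply hj, psi_apply, fourier_sub_apply]
      simp only [Complex.mul_re, Complex.conj_re, Complex.conj_im]
      ring
    simp only [h2, this]
    field_simp

lemma integral_psi_sub_mul_marginal (j : ℕ) (s : UnitAddCircle) :
    ∫ t, psi j (s - t) * marginal a k t = eig b j * psi j s := by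
  rcases eq_or_ne j 0 with rfl | hj
  · simp [psi_apply]
  · have := integral_trig_mul_marginal hak hb j (fourier (j : ℤ) s).im (-(fourier (j : ℤ) s).re)
    rw [eig, if_neg hj, psi_apply]
    have h2 : ∀ t, psi j (s - t) = (fourier (j : ℤ) s).im * phi j t +
        -(fourier (j : ℤ) s).re * psi j t := fun t => by
      rw [phi_apply hj, psi_apply, psi_apply, fourier_sub_apply]
      simp only [Complex.mul_im, Complex.conj_re, Complex.conj_im]
      ring
    simp only [h2, this]
    field_simp

lemma integral_phi_add_mul_marginal (j : ℕ) (s : UnitAddCircle) :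
    ∫ t, phi j (t + s) * marginal a k t = eig b j * phi j s := by
  rcases eq_or_ne j 0 with rfl | hj
  · simpa [phi_zero_apply, eig] using integral_phi_mul_marginal hak hb 0
  · have := integral_trig_mul_marginal hak hb j (fourier (j : ℤ) s).re (-(fourier (j : ℤ) s).im)
    rw [eig, if_neg hj, phi_apply hj]
    have h2 : ∀ t, phi j (t + s) = (fourier (j : ℤ) s).re * phi j t +
        -(fourier (j : ℤ) s).im * psi j t := fun t => by
      rw [phi_apply hj, phi_apply hj, psi_apply, fourier_add_apply]
      simp only [Complex.mul_re]
      ring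
    simp only [h2, this]
    field_simp

end Marginal

instance : (volume : Measure UnitAddCircle).IsNegInvariant := by
  rw [volume_circle_eq_haar]
  infer_instance

instance : (volume : Measure (UnitAddTorus (Fin d))).IsNegInvariant := by
  rw [volume_pi]
  infer_instance

/-- The convolution of a function of one coordinate only involves the marginal. The value holds at
every point `x`, since `conv` depends on `f` only up to null sets. -/
lemma conv_eq_of_coordinate {a : UnitAddTorus (Fin d) → ℝ} (ha : Integrable a) (k : Fin d)
    (u : C(UnitAddCircle, ℝ)) {f : UnitAddTorus (Fin d) → ℝ}
    (hf : f =ᵐ[volume] fun y => u (y k)) (x : UnitAddTorus (Fin d)) :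
    conv a f x = ∫ t, u (x k - t) * marginal a k t := by
  let v : C(UnitAddCircle, ℝ) := ⟨fun t => u (x k - t), by fun_prop⟩
  calc conv a f x = ∫ y, a (x - y) * u (y k) := by
        refine integral_congr_ae ?_
        filter_upwards [hf] with y hy
        rw [hy]
    _ = ∫ y, (fun z => v (z k) * a z) (x - y) := by
        refine integral_congr_ae (ae_of_all _ fun y => ?_)
        simp only [v, ContinuousMap.coe_mk, Pi.sub_apply, sub_sub_cancel]
        ring
    _ = ∫ z, v (z k) * a z := integral_sub_left_eq_self (fun z => v (z k) * a z) volume x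
    _ = _ := integral_marginal_mul ha k v

/-- The adjoint of the convolution, applied to a function of one coordinate. The kernel
`a (x - y) f y u (x_k)` is integrable because `u` is bounded, so that Fubini's theorem applies. -/
lemma integral_conv_mul {a : UnitAddTorus (Fin d) → ℝ} (ha : Integrable a) (k : Fin d)
    (u : C(UnitAddCircle, ℝ)) {f : UnitAddTorus (Fin d) → ℝ} (hf : Integrable f) :
    ∫ x, conv a f x * u (x k) = ∫ y, f y * ∫ t, u (t + y k) * marginal a k t := by
  have hint : Integrable (fun p : UnitAddTorus (Fin d) × UnitAddTorus (Fin d) =>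
      a (p.1 - p.2) * f p.2 * u (p.1 k)) (volume.prod volume) := by
    have h1 := (measurePreserving_sub_prod (volume : Measure (UnitAddTorus (Fin d)))
      (volume : Measure (UnitAddTorus (Fin d)))).integrable_comp_of_integrable (ha.mul_prod hf)
    refine h1.mul_bdd (c := ‖u‖) ?_ (ae_of_all _ fun _ => u.norm_coe_le_norm _)
    exact (u.continuous.comp ((continuous_apply k).comp continuous_fst)).aestronglyMeasurable
  calc ∫ x, conv a f x * u (x k) = ∫ x, ∫ y, a (x - y) * f y * u (x k) := by
        simp only [conv, integral_mul_const]
    _ = ∫ y, ∫ x, a (x - y) * f y * u (x k) := integral_integral_swap hint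
    _ = ∫ y, f y * ∫ t, u (t + y k) * marginal a k t := by
        refine integral_congr_ae (ae_of_all _ fun y => ?_)
        let v : C(UnitAddCircle, ℝ) := ⟨fun t => u (t + y k), by fun_prop⟩
        change _ = f y * ∫ t, v t * marginal a k t
        rw [← integral_marginal_mul ha k v, ← integral_const_mul,
          ← integral_sub_right_eq_self (fun z => f y * (v (z k) * a z)) y]
        refine integral_congr_ae (ae_of_all _ fun x => ?_)
        simp only [v, ContinuousMap.coe_mk, Pi.sub_apply, sub_add_cancel]
        ring

end

section

variable {d : ℕ}

/-! ### The adjoint of the inverse operator -/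

lemma lift_mem_additiveSpace (k : Fin d) (g : L2One) : lift k g ∈ additiveSpace d := by
  classical
  refine ⟨Pi.single k g, fun _ => Set.mem_univ _, ?_⟩
  rw [Finset.sum_eq_single k (fun l _ hl => ?_) (by simp), Pi.single_eq_same]
  rw [Pi.single_eq_of_ne hl, ← liftₗᵢ_apply, map_zero]

lemma addBasis_mem_additiveSpace (k₀ : Fin d) (i : Option (Fin d × ℕ)) :
    addBasis k₀ i ∈ additiveSpace d := by
  rcases i with _ | ⟨k, j⟩ <;> exact lift_mem_additiveSpace _ _

lemma add_mem_additiveSpace {f g : L2Torus d} (hf : f ∈ additiveSpace d)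
    (hg : g ∈ additiveSpace d) : f + g ∈ additiveSpace d := by
  obtain ⟨u, -, rfl⟩ := hf
  obtain ⟨v, -, rfl⟩ := hg
  refine ⟨u + v, fun _ => Set.mem_univ _, ?_⟩
  simp only [Pi.add_apply, ← liftₗᵢ_apply, map_add, Finset.sum_add_distrib]

lemma smul_mem_additiveSpace (c : ℝ) {f : L2Torus d} (hf : f ∈ additiveSpace d) :
    c • f ∈ additiveSpace d := by
  obtain ⟨u, -, rfl⟩ := hf
  refine ⟨c • u, fun _ => Set.mem_univ _, ?_⟩
  simp only [Pi.smul_apply, ← liftₗᵢ_apply, map_smul, Finset.smul_sum]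

lemma sum_mem_additiveSpace (k₀ : Fin d) {ι : Type*} (s : Finset ι) {f : ι → L2Torus d}
    (hf : ∀ i, f i ∈ additiveSpace d) : ∑ i ∈ s, f i ∈ additiveSpace d := by
  classical
  induction s using Finset.induction_on with
  | empty =>
    rw [Finset.sum_empty, ← zero_smul ℝ (lift k₀ (phiLp 0))]
    exact smul_mem_additiveSpace 0 (lift_mem_additiveSpace _ _)
  | insert i s hi ih =>
    rw [Finset.sum_insert hi]
    exact add_mem_additiveSpace (hf i) ih

/-- An additive function is determined by its inner products with the trigonometric functions of
one coordinate. -/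
lemma eq_of_inner_lift_trig_eq {q q' : L2Torus d} (hq : q ∈ additiveSpace d)
    (hq' : q' ∈ additiveSpace d)
    (h1 : ∀ k j, inner ℝ (lift k (phiLp j)) q = inner ℝ (lift k (phiLp j)) q')
    (h2 : ∀ k j, inner ℝ (lift k (psiLp j)) q = inner ℝ (lift k (psiLp j)) q') : q = q' := by
  set r := q - q' with hr
  have hlift : ∀ k g, inner ℝ (lift k g) r = 0 := fun k g => by
    have hz : (liftₗᵢ k).toContinuousLinearMap.adjoint r = 0 := by
      refine eq_zero_of_inner_trig_eq_zero (fun j => ?_) fun j => ?_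
      · rw [ContinuousLinearMap.adjoint_inner_right, hr]
        exact (inner_sub_right _ _ _).trans (sub_eq_zero.2 (h1 k j))
      · rw [ContinuousLinearMap.adjoint_inner_right, hr]
        exact (inner_sub_right _ _ _).trans (sub_eq_zero.2 (h2 k j))
    have := ContinuousLinearMap.adjoint_inner_right (liftₗᵢ k).toContinuousLinearMap g r
    rw [hz, inner_zero_right] at this
    exact this.symm
  obtain ⟨g, -, hg⟩ := add_mem_additiveSpace hq (smul_mem_additiveSpace (-1) hq')
  have hrg : r = ∑ k, lift k (g k) := by rw [← hg, hr]; simp [sub_eq_add_neg]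
  have h0 : inner ℝ r r = 0 := by
    nth_rewrite 1 [hrg]
    rw [sum_inner]
    exact Finset.sum_eq_zero fun k _ => hlift k _
  exact sub_eq_zero.1 (inner_self_eq_zero.1 h0)

/-- The eigenvalues of the convolution operator on the basis `addBasis`. -/
def addEig (k₀ : Fin d) (b : Fin d → ℕ → ℝ) : Option (Fin d × ℕ) → ℝ
  | none => eig (b k₀) 0
  | some (k, j) => eig (b k) (j + 1)

lemma eig_pos {b : ℕ → ℝ} (h : ∀ j, 0 < b j) (j : ℕ) : 0 < eig b j := by
  unfold eig
  split_ifs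
  · exact h 0
  · exact div_pos (h j) (by positivity)

lemma addEig_pos (k₀ : Fin d) {b : Fin d → ℕ → ℝ} (h : ∀ k j, 0 < b k j)
    (i : Option (Fin d × ℕ)) : 0 < addEig k₀ b i := by
  rcases i with _ | ⟨k, j⟩ <;> exact eig_pos (h _) _

lemma integrable_conv {a : UnitAddTorus (Fin d) → ℝ} (ha : Integrable a)
    {f : UnitAddTorus (Fin d) → ℝ} (hf : Integrable f) : Integrable (conv a f) := by
  have h1 := (measurePreserving_sub_prod (volume : Measure (UnitAddTorus (Fin d)))
    (volume : Measure (UnitAddTorus (Fin d)))).integrable_comp_of_integrable (ha.mul_prod hf)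
  exact h1.integral_prod_left

section Operator

variable {a : UnitAddTorus (Fin d) → ℝ} (ha : Integrable a)
  (hak : ∀ k, MemLp (marginal a k) 2) {b : Fin d → ℕ → ℝ}
  (hb : ∀ k, HasSum (fun j => b k j • phiLp j) (hak k).toLp)

include ha hb

lemma integral_conv_mul_lift (k : Fin d) (j : ℕ) (f : L2Torus d) :
    Integrable (fun x => conv a f x * lift k (phiLp j) x) ∧
    ∫ x, conv a f x * lift k (phiLp j) x = eig (b k) j * inner ℝ (lift k (phiLp j)) f := by
  have hae : (fun x => conv a f x * lift k (phiLp j) x) =ᵐ[volume]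
      fun x => conv a f x * phi j (x k) := by
    filter_upwards [coeFn_lift_toLp k (phi j)] with x hx
    rw [phiLp, hx]
  constructor
  · rw [integrable_congr hae]
    simpa only [mul_comm] using integrable_bdd_mul k (phi j) (integrable_conv ha (integrable_L2 f))
  · rw [integral_congr_ae hae, integral_conv_mul ha k _ (integrable_L2 f)]
    simp only [integral_phi_add_mul_marginal (hak k) (hb k)]
    rw [phiLp, inner_lift_toLp, ← integral_const_mul]
    congr 1
    ext x
    ring

lemma conv_lift_phi (k : Fin d) (j : ℕ) (x : UnitAddTorus (Fin d)) :
    conv a (lift k (phiLp j)) x = eig (b k) j * phi j (x k) := by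
  rw [phiLp, conv_eq_of_coordinate ha k (phi j) (coeFn_lift_toLp k _),
    integral_phi_sub_mul_marginal (hak k) (hb k)]

lemma conv_lift_psi (k : Fin d) (j : ℕ) (x : UnitAddTorus (Fin d)) :
    conv a (lift k (psiLp j)) x = eig (b k) j * psi j (x k) := by
  rw [psiLp, conv_eq_of_coordinate ha k (psi j) (coeFn_lift_toLp k _),
    integral_psi_sub_mul_marginal (hak k) (hb k)]

/-- The image of a trigonometric polynomial in one coordinate, tested against any `h ∈ L²`. -/
lemma integral_conv_lift_sum (k : Fin d) (s : Finset ℕ) (c : ℕ → ℝ) (h : L2Torus d) :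
    ∫ x, conv a (lift k (∑ j ∈ s, c j • phiLp j)) x * h x =
      ∑ j ∈ s, c j * eig (b k) j * inner ℝ (lift k (phiLp j)) h := by
  have hu : (∑ j ∈ s, c j • phiLp j) =
      ContinuousMap.toLp 2 volume ℝ (∑ j ∈ s, c j • phi j) := by
    simp [phiLp]
  have hi : ∀ (u : C(UnitAddCircle, ℝ)), Integrable fun t => u t * marginal a k t := fun u =>
    ((hak k).integrable (by norm_num)).bdd_mul u.continuous.aestronglyMeasurable
      (c := ‖u‖) (ae_of_all _ fun _ => u.norm_coe_le_norm _)
  have hconv : ∀ x, conv a (lift k (∑ j ∈ s, c j • phiLp j)) x =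
      ∑ j ∈ s, c j * eig (b k) j * phi j (x k) := fun x => by
    rw [hu, conv_eq_of_coordinate ha k _ (coeFn_lift_toLp k _)]
    simp only [ContinuousMap.coe_sum, Finset.sum_apply, ContinuousMap.coe_smul, Pi.smul_apply,
      smul_eq_mul, Finset.sum_mul, mul_assoc]
    rw [integral_finsetSum]
    · refine Finset.sum_congr rfl fun j _ => ?_
      rw [integral_const_mul, integral_phi_sub_mul_marginal (hak k) (hb k)]
    · intro j _
      exact (hi ⟨fun t => phi j (x k - t), by fun_prop⟩).const_mul _
  simp only [hconv, Finset.sum_mul, mul_assoc]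
  rw [integral_finsetSum]
  · refine Finset.sum_congr rfl fun j _ => ?_
    rw [integral_const_mul, integral_const_mul, phiLp, inner_lift_toLp]
  · intro j _
    exact ((integrable_bdd_mul k (phi j) (integrable_L2 h)).const_mul _).const_mul _

/-- The value of `(A⁻¹)*` is unique: the range of `A` on additive functions contains all
trigonometric functions of one coordinate. -/
lemma isAdjointInverseAt_unique (hpos : ∀ k j, 0 < b k j) {g q q' : L2Torus d}
    (hq : IsAdjointInverseAt a g q) (hq' : IsAdjointInverseAt a g q') : q = q' := by
  have key : ∀ f ∈ additiveSpace d, ∫ x, conv a f x * q x = ∫ x, conv a f x * q' x :=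
    fun f hf => (hq.2 f hf).symm.trans (hq'.2 f hf)
  refine eq_of_inner_lift_trig_eq hq.1 hq'.1 (fun k j => ?_) fun k j => ?_
  · have := key _ (lift_mem_additiveSpace k (phiLp j))
    simp only [conv_lift_phi ha hak hb, mul_assoc, integral_const_mul] at this
    rw [phiLp, inner_lift_toLp, inner_lift_toLp]
    exact mul_left_cancel₀ (eig_pos (hpos k) j).ne' this
  · have := key _ (lift_mem_additiveSpace k (psiLp j))
    simp only [conv_lift_psi ha hak hb, mul_assoc, integral_const_mul] at this
    rw [psiLp, inner_lift_toLp, inner_lift_toLp]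
    exact mul_left_cancel₀ (eig_pos (hpos k) j).ne' this

lemma integral_conv_mul_addBasis (k₀ : Fin d) (i : Option (Fin d × ℕ)) (f : L2Torus d) :
    Integrable (fun x => conv a f x * addBasis k₀ i x) ∧
    ∫ x, conv a f x * addBasis k₀ i x = addEig k₀ b i * inner ℝ (addBasis k₀ i) f := by
  rcases i with _ | ⟨k, j⟩ <;> exact integral_conv_mul_lift ha hak hb _ _ f

lemma integral_conv_mul_sum (k₀ : Fin d) (s : Finset (Option (Fin d × ℕ)))
    (c : Option (Fin d × ℕ) → ℝ) (f : L2Torus d) :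
    Integrable (fun x => conv a f x * (∑ i ∈ s, c i • addBasis k₀ i : L2Torus d) x) ∧
    ∫ x, conv a f x * (∑ i ∈ s, c i • addBasis k₀ i : L2Torus d) x =
      ∑ i ∈ s, c i * (addEig k₀ b i * inner ℝ (addBasis k₀ i) f) := by
  classical
  induction s using Finset.induction_on with
  | empty =>
    have hae : (fun x => conv a f x * (0 : L2Torus d) x) =ᵐ[volume] fun _ => (0 : ℝ) := by
      filter_upwards [Lp.coeFn_zero ℝ 2 (volume : Measure (UnitAddTorus (Fin d)))] with x hx
      rw [hx]; simp
    simp only [Finset.sum_empty]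
    exact ⟨(integrable_congr hae).2 (integrable_zero _ _ _), by rw [integral_congr_ae hae]; simp⟩
  | insert i s hi ih =>
    obtain ⟨h1, h2⟩ := integral_conv_mul_addBasis ha hak hb k₀ i f
    have hae : (fun x => conv a f x *
        (∑ i ∈ insert i s, c i • addBasis k₀ i : L2Torus d) x) =ᵐ[volume]
        fun x => c i * (conv a f x * addBasis k₀ i x) +
          conv a f x * (∑ i ∈ s, c i • addBasis k₀ i : L2Torus d) x := by
      rw [Finset.sum_insert hi]
      filter_upwards [Lp.coeFn_add (c i • addBasis k₀ i) (∑ i ∈ s, c i • addBasis k₀ i),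
        Lp.coeFn_smul (c i) (addBasis k₀ i)] with x hx1 hx2
      rw [hx1, Pi.add_apply, hx2, Pi.smul_apply, smul_eq_mul]
      ring
    refine ⟨(integrable_congr hae).2 ((h1.const_mul _).add ih.1), ?_⟩
    rw [integral_congr_ae hae, integral_add (h1.const_mul _) ih.1, integral_const_mul, h2, ih.2,
      Finset.sum_insert hi]

lemma isAdjointInverseAt_sum (hpos : ∀ k j, 0 < b k j) (k₀ : Fin d)
    (s : Finset (Option (Fin d × ℕ))) (c : Option (Fin d × ℕ) → ℝ) :
    IsAdjointInverseAt a (∑ i ∈ s, c i • addBasis k₀ i)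
      (∑ i ∈ s, (c i / addEig k₀ b i) • addBasis k₀ i) := by
  refine ⟨sum_mem_additiveSpace k₀ s fun i =>
    smul_mem_additiveSpace _ (addBasis_mem_additiveSpace k₀ i), fun f _ => ?_⟩
  rw [(integral_conv_mul_sum ha hak hb k₀ s _ f).2]
  have : ∫ x, f x * (∑ i ∈ s, c i • addBasis k₀ i : L2Torus d) x =
      inner ℝ (∑ i ∈ s, c i • addBasis k₀ i) f := by
    rw [L2.inner_def]
    simp
  rw [this, sum_inner]
  refine Finset.sum_congr rfl fun i _ => ?_
  rw [inner_smul_left, ← mul_assoc, div_mul_cancel₀ _ (addEig_pos k₀ hpos i).ne']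
  simp

/-- `Q` is diagonal in the basis `addBasis`, with the reciprocals of the eigenvalues of `A`. -/
lemma Q_sum (hpos : ∀ k j, 0 < b k j) (k₀ : Fin d)
    (s : Finset (Option (Fin d × ℕ))) (c : Option (Fin d × ℕ) → ℝ) :
    Q a (∑ i ∈ s, c i • addBasis k₀ i) = ∑ i ∈ s, (c i / addEig k₀ b i) • addBasis k₀ i := by
  have hex : ∃ q, IsAdjointInverseAt a (∑ i ∈ s, c i • addBasis k₀ i) q :=
    ⟨_, isAdjointInverseAt_sum ha hak hb hpos k₀ s c⟩
  rw [Q, dif_pos hex]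
  exact isAdjointInverseAt_unique ha hak hb hpos hex.choose_spec
    (isAdjointInverseAt_sum ha hak hb hpos k₀ s c)

lemma integral_conv_mul_Q (hpos : ∀ k j, 0 < b k j) (k₀ : Fin d)
    (s : Finset (Option (Fin d × ℕ))) (c : Option (Fin d × ℕ) → ℝ) (f : L2Torus d) :
    ∫ x, conv a f x * Q a (∑ i ∈ s, c i • addBasis k₀ i) x =
      inner ℝ (∑ i ∈ s, c i • addBasis k₀ i) f := by
  rw [Q_sum ha hak hb hpos, (integral_conv_mul_sum ha hak hb k₀ s _ f).2, sum_inner]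
  refine Finset.sum_congr rfl fun i _ => ?_
  rw [inner_smul_left, ← mul_assoc, div_mul_cancel₀ _ (addEig_pos k₀ hpos i).ne']
  simp

end Operator

end

section

variable {d : ℕ}

/-! ### Minimizers of the empirical risk -/

lemma measurable_empiricalRisk (a : UnitAddTorus (Fin d) → ℝ) (g : L2Torus d) :
    Measurable fun y : L2Torus d → ℝ => empiricalRisk a y g := by
  unfold empiricalRisk
  have : Measurable fun y : L2Torus d → ℝ => y (Q a g) := measurable_pi_apply _
  fun_prop

/-- Over a finite set a measurable minimizer exists; it is built by comparing the candidates one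
after the other. -/
lemma exists_isMinimizerOver (a : UnitAddTorus (Fin d) → ℝ) {S : Set (L2Torus d)}
    (hS : S.Finite) (hne : S.Nonempty) : ∃ fhat, IsMinimizerOver a S fhat := by
  classical
  let _ : MeasurableSpace (L2Torus d) := borel (L2Torus d)
  suffices h : ∀ T : Finset (L2Torus d), T.Nonempty → ∃ fhat : (L2Torus d → ℝ) → L2Torus d,
      Measurable fhat ∧ Measurable (fun y => empiricalRisk a y (fhat y)) ∧
      ∀ y, fhat y ∈ T ∧ ∀ g ∈ T, empiricalRisk a y (fhat y) ≤ empiricalRisk a y g by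
    obtain ⟨fhat, h1, -, h3⟩ := h hS.toFinset (by simpa using hne)
    exact ⟨fhat, h1, fun y => by simpa using h3 y⟩
  intro T hT
  induction hT using Finset.Nonempty.cons_induction with
  | singleton g =>
    exact ⟨fun _ => g, measurable_const, measurable_empiricalRisk a g, fun y => by simp⟩
  | cons g T hg hT ih =>
    obtain ⟨fhat, h1, h2, h3⟩ := ih
    have hset : MeasurableSet {y : L2Torus d → ℝ |
        empiricalRisk a y g ≤ empiricalRisk a y (fhat y)} :=
      measurableSet_le (measurable_empiricalRisk a g) h2
    refine ⟨fun y => if empiricalRisk a y g ≤ empiricalRisk a y (fhat y) then g else fhat y,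
      Measurable.ite hset measurable_const h1, ?_, fun y => ?_⟩
    · have : (fun y => empiricalRisk a y
          (if empiricalRisk a y g ≤ empiricalRisk a y (fhat y) then g else fhat y)) =
          fun y => if empiricalRisk a y g ≤ empiricalRisk a y (fhat y) then empiricalRisk a y g
            else empiricalRisk a y (fhat y) := by
        ext y; split_ifs <;> rfl
      rw [this]
      exact Measurable.ite hset (measurable_empiricalRisk a g) h2
    · obtain ⟨hmem, hmin⟩ := h3 y
      beta_reduce
      split_ifs with hle
      · refine ⟨by simp, fun g' hg' => ?_⟩
        rcases Finset.mem_cons.1 hg' with rfl | hg'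
        · exact le_rfl
        · exact hle.trans (hmin g' hg')
      · refine ⟨by simp [hmem], fun g' hg' => ?_⟩
        rcases Finset.mem_cons.1 hg' with rfl | hg'
        · exact (not_le.1 hle).le
        · exact hmin g' hg'

/-! ### The risk of a minimizer over a subset of a finite-dimensional space -/

lemma eq_sum_of_mem_span {H ι : Type*} [NormedAddCommGroup H] [InnerProductSpace ℝ H]
    {e : ι → H} (he : Orthonormal ℝ e) (s : Finset ι) {x : H}
    (hx : x ∈ Submodule.span ℝ (e '' s)) : x = ∑ i ∈ s, (inner ℝ (e i) x : ℝ) • e i := by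
  classical
  induction hx using Submodule.span_induction with
  | mem x hx =>
    obtain ⟨i, hi, rfl⟩ := hx
    rw [Finset.sum_eq_single i (fun j _ hj => by rw [he.2 hj, zero_smul])
      (fun h => absurd hi h), real_inner_self_eq_norm_sq, he.1 i]
    simp
  | zero => simp
  | add x y _ _ hx hy =>
    simp only [inner_add_right, add_smul, Finset.sum_add_distrib]
    rw [← hx, ← hy]
  | smul c x _ hx =>
    simp only [inner_smul_right, mul_smul, ← Finset.smul_sum]
    rw [← hx]

/-- Solves the quadratic inequality of the oracle bound: `D` and `D₀` are the errors of the
minimizer and of its competitor, `X` the noise increment and `Y` the distance of the two. -/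
lemma le_of_quadratic {D D₀ z X Y : ℝ} (hY : Y ≤ D + D₀) (hY0 : 0 ≤ Y)
    (hz : 0 ≤ z) (hX : X ^ 2 ≤ z * Y ^ 2) (h : D ^ 2 ≤ D₀ ^ 2 + 2 * X) :
    D ^ 2 ≤ 4 * D₀ ^ 2 + 6 * z := by
  have hX' : X ≤ √z * Y := by
    refine abs_le_of_sq_le_sq' ?_ (by positivity) |>.2
    rwa [mul_pow, Real.sq_sqrt hz]
  have hX2 : X ≤ √z * (D + D₀) := hX'.trans (mul_le_mul_of_nonneg_left hY (Real.sqrt_nonneg z))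
  have hs := Real.sq_sqrt hz
  nlinarith [sq_nonneg (D - 2 * √z), sq_nonneg (D₀ - √z)]

variable {Ω : Type*} [MeasurableSpace Ω] {P : Measure Ω} [IsProbabilityMeasure P]
  {W : L2Torus d → Ω → ℝ}

/-- Oracle inequality for the minimizer of the empirical risk over a finite set `S` in the span of
the basis functions with index in `s`. The increments of the noise `W ∘ Q` over `S` are controlled
by the Cauchy–Schwarz inequality in that span. -/
lemma mise_le {a : UnitAddTorus (Fin d) → ℝ} (ha : Integrable a)
    (hak : ∀ k, MemLp (marginal a k) 2) {b : Fin d → ℕ → ℝ}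
    (hb : ∀ k, HasSum (fun j => b k j • phiLp j) (hak k).toLp)
    (hpos : ∀ k j, 0 < b k j) (k₀ : Fin d) (hW : IsWhiteNoise P W)
    {S : Set (L2Torus d)} (hS : S.Finite) (s : Finset (Option (Fin d × ℕ)))
    (hspan : S ⊆ Submodule.span ℝ (addBasis k₀ '' s)) {n : ℕ}
    {fhat : (L2Torus d → ℝ) → L2Torus d} (hf : IsMinimizerOver a S fhat)
    {g₀ : L2Torus d} (hg₀ : g₀ ∈ S) (f : L2Torus d) :
    mise P a W n fhat f ≤ ENNReal.ofReal
      (4 * ‖g₀ - f‖ ^ 2 + 6 * ((n : ℝ)⁻¹ * ∑ i ∈ s, ((addEig k₀ b i) ^ 2)⁻¹)) := by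
  set e := addBasis k₀
  set lam := addEig k₀ b
  have hon : Orthonormal ℝ e := orthonormal_addBasis k₀
  have hrep : ∀ g ∈ S, g = ∑ i ∈ s, (inner ℝ (e i) g : ℝ) • e i := fun g hg =>
    eq_sum_of_mem_span hon s (hspan hg)
  set N : Ω → ℝ := fun ω => ∑ i ∈ s, (W (e i) ω / lam i) ^ 2 with hN
  have hnoise : ∀ᵐ ω ∂P, ∀ g ∈ S,
      W (Q a g) ω = ∑ i ∈ s, inner ℝ (e i) g / lam i * W (e i) ω := by
    rw [ae_ball_iff hS.countable]
    intro g hg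
    have hQ : Q a g = ∑ i ∈ s, (inner ℝ (e i) g / lam i) • e i := by
      conv_lhs => rw [hrep g hg]
      exact Q_sum ha hak hb hpos k₀ s _
    rw [hQ]
    exact hW.ae_sum_smul s _ _
  have hsig : ∀ g ∈ S, ∫ x, conv a f x * Q a g x = inner ℝ g f := fun g hg => by
    conv_lhs => rw [hrep g hg]
    conv_rhs => rw [hrep g hg]
    exact integral_conv_mul_Q ha hak hb hpos k₀ s _ f
  have hbound : ∀ᵐ ω ∂P, ‖fhat (observation a W n f ω) - f‖ ^ 2 ≤
      4 * ‖g₀ - f‖ ^ 2 + 6 * ((n : ℝ)⁻¹ * N ω) := by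
    filter_upwards [hnoise] with ω hω
    obtain ⟨hmem, hmin⟩ := hf.2 (observation a W n f ω)
    set g := fhat (observation a W n f ω) with hg
    have hrisk : ∀ g ∈ S, empiricalRisk a (observation a W n f ω) g =
        -2 * (inner ℝ g f + (√(n : ℝ))⁻¹ * ∑ i ∈ s, inner ℝ (e i) g / lam i * W (e i) ω) +
          ‖g‖ ^ 2 := fun g hg => by
      rw [empiricalRisk, observation, hsig g hg, hω g hg]
    have hle := hmin g₀ hg₀
    rw [hrisk g hmem, hrisk g₀ hg₀] at hle
    set X : ℝ := (√(n : ℝ))⁻¹ * ∑ i ∈ s, inner ℝ (e i) (g - g₀) * (W (e i) ω / lam i) with hX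
    have hXeq : X = (√(n : ℝ))⁻¹ * ∑ i ∈ s, inner ℝ (e i) g / lam i * W (e i) ω -
        (√(n : ℝ))⁻¹ * ∑ i ∈ s, inner ℝ (e i) g₀ / lam i * W (e i) ω := by
      rw [hX, ← mul_sub, ← Finset.sum_sub_distrib]
      congr 1
      refine Finset.sum_congr rfl fun i _ => ?_
      rw [inner_sub_right]
      ring
    refine le_of_quadratic (Y := ‖g - g₀‖) (X := X) (z := (n : ℝ)⁻¹ * N ω) ?_ (norm_nonneg _)
      (mul_nonneg (by positivity) (Finset.sum_nonneg fun i _ => sq_nonneg _)) ?_ ?_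
    · calc ‖g - g₀‖ = ‖(g - f) - (g₀ - f)‖ := by rw [sub_sub_sub_cancel_right]
        _ ≤ _ := norm_sub_le _ _
    · rw [hX, mul_pow, inv_pow, Real.sq_sqrt (Nat.cast_nonneg n), mul_assoc]
      refine mul_le_mul_of_nonneg_left ?_ (by positivity)
      refine (Finset.sum_mul_sq_le_sq_mul_sq s _ _).trans ?_
      rw [mul_comm]
      refine mul_le_mul_of_nonneg_left ?_ (Finset.sum_nonneg fun i _ => sq_nonneg _)
      have := hon.sum_inner_products_le (g - g₀) (s := s)
      simpa [Real.norm_eq_abs, sq_abs] using this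
    · rw [norm_sub_sq_real, norm_sub_sq_real]
      linarith
  have hN2 : ∀ i, Integrable (fun ω => (W (e i) ω / lam i) ^ 2) P := fun i => by
    have : (fun ω => (W (e i) ω / lam i) ^ 2) =
        fun ω => (lam i ^ 2)⁻¹ * (W (e i) ω * W (e i) ω) := by
      ext ω; rw [div_pow]; ring
    rw [this]
    exact (hW.integrable_mul _ _).const_mul _
  have hNint : Integrable N P := integrable_finsetSum _ fun i _ => hN2 i
  have hNexp : ∫ ω, N ω ∂P = ∑ i ∈ s, (lam i ^ 2)⁻¹ := by
    rw [hN, integral_finsetSum _ fun i _ => hN2 i]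
    refine Finset.sum_congr rfl fun i _ => ?_
    have : (fun ω => (W (e i) ω / lam i) ^ 2) =
        fun ω => (lam i ^ 2)⁻¹ * (W (e i) ω * W (e i) ω) := by
      ext ω; rw [div_pow]; ring
    rw [this, integral_const_mul, hW.covariance, real_inner_self_eq_norm_sq, hon.1 i]
    simp
  have hBint : Integrable (fun ω => 4 * ‖g₀ - f‖ ^ 2 + 6 * ((n : ℝ)⁻¹ * N ω)) P :=
    (integrable_const _).add ((hNint.const_mul _).const_mul _)
  calc mise P a W n fhat f ≤
        ∫⁻ ω, ENNReal.ofReal (4 * ‖g₀ - f‖ ^ 2 + 6 * ((n : ℝ)⁻¹ * N ω)) ∂P := by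
        refine lintegral_mono_ae ?_
        filter_upwards [hbound] with ω hω
        exact ENNReal.ofReal_le_ofReal hω
    _ = ENNReal.ofReal (∫ ω, 4 * ‖g₀ - f‖ ^ 2 + 6 * ((n : ℝ)⁻¹ * N ω) ∂P) := by
        rw [ofReal_integral_eq_lintegral_ofReal hBint]
        exact ae_of_all _ fun ω => add_nonneg (by positivity) (mul_nonneg (by norm_num)
          (mul_nonneg (by positivity) (Finset.sum_nonneg fun i _ => sq_nonneg _)))
    _ = _ := by
        rw [integral_add (integrable_const _) ((hNint.const_mul _).const_mul _),
          integral_const, integral_const_mul, integral_const_mul, hNexp]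
        simp

end

/-! ### Counting lattice points -/

/-- Two geometric series, of ratio `exp (-x) ≤ 1 - x / 2`. -/
lemma sum_exp_neg_abs_le {x : ℝ} (hx : 0 < x) (hx1 : x ≤ 1) (A : Finset ℤ) :
    ∑ m ∈ A, Real.exp (-(x * |(m : ℝ)|)) ≤ 4 / x := by
  classical
  set r := Real.exp (-x) with hr
  have hr0 : 0 ≤ r := (Real.exp_pos _).le
  have hr1 : r < 1 := by rw [hr, Real.exp_lt_one_iff]; linarith
  have hgeo : ∀ B : Finset ℕ, ∑ n ∈ B, r ^ n ≤ 2 / x := fun B => by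
    refine ((summable_geometric_of_lt_one hr0 hr1).sum_le_tsum B
      fun n _ => pow_nonneg hr0 n).trans ?_
    rw [tsum_geometric_of_lt_one hr0 hr1, inv_le_comm₀ (by linarith) (by positivity), inv_div]
    have h1 : r ≤ (1 + x)⁻¹ := by
      rw [hr, Real.exp_neg]
      exact inv_anti₀ (by linarith) (by linarith [Real.add_one_le_exp x])
    have h2 : (1 + x)⁻¹ ≤ 1 - x / 2 := by
      rw [inv_le_iff_one_le_mul₀ (by linarith)]
      nlinarith
    linarith
  have hterm : ∀ m : ℤ, Real.exp (-(x * |(m : ℝ)|)) = r ^ m.natAbs := fun m => by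
    rw [hr, ← Real.exp_nat_mul, Nat.cast_natAbs, Int.cast_abs]
    ring_nf
  have hhalf : ∀ B : Finset ℤ, Set.InjOn Int.natAbs (B : Set ℤ) →
      ∑ m ∈ B, r ^ m.natAbs ≤ 2 / x := fun B hB => by
    rw [← Finset.sum_image (f := fun n => r ^ n) hB]
    exact hgeo _
  simp only [hterm]
  rw [← Finset.sum_filter_add_sum_filter_not A (fun m => 0 ≤ m)]
  have h1 := hhalf (A.filter fun m => 0 ≤ m) fun m hm m' hm' h => by
    simp only [Finset.coe_filter, Set.mem_ofPred_eq] at hm hm'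
    omega
  have h2 := hhalf (A.filter fun m => ¬ 0 ≤ m) fun m hm m' hm' h => by
    simp only [Finset.coe_filter, Set.mem_ofPred_eq] at hm hm'
    omega
  calc _ ≤ 2 / x + 2 / x := add_le_add h1 h2
    _ = 4 / x := by ring

/-- Number of lattice points in a weighted `ℓ¹` ball, by the exponential Markov inequality. -/
lemma ncard_lattice_le {ι : Type*} [Fintype ι] {x : ι → ℝ} (hx : ∀ i, 0 < x i)
    (hx1 : ∀ i, x i ≤ 1) {K : ℝ} {T : Set (ι → ℤ)}
    (hT : ∀ m ∈ T, ∑ i, x i * |(m i : ℝ)| ≤ K) :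
    T.Finite ∧ (T.ncard : ℝ) ≤ Real.exp K * ∏ i, (4 / x i) := by
  classical
  have hfin : T.Finite := by
    refine (Set.Finite.pi (t := fun i => Set.Icc (-⌈K / x i⌉) ⌈K / x i⌉)
      fun i => Set.finite_Icc _ _).subset fun m hm i _ => ?_
    have h1 : x i * |(m i : ℝ)| ≤ K :=
      (Finset.single_le_sum (f := fun i => x i * |(m i : ℝ)|)
        (fun j _ => mul_nonneg (hx j).le (abs_nonneg _)) (Finset.mem_univ i)).trans (hT m hm)
    have h2 : ((|m i| : ℤ) : ℝ) ≤ ⌈K / x i⌉ := by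
      rw [Int.cast_abs]
      refine le_trans ?_ (Int.le_ceil _)
      rw [le_div_iff₀ (hx i)]
      linarith
    exact abs_le.1 (Int.cast_le.1 h2)
  refine ⟨hfin, ?_⟩
  have hsub : hfin.toFinset ⊆ Fintype.piFinset fun i => hfin.toFinset.image fun m : ι → ℤ => m i :=
    fun m hm => Fintype.mem_piFinset.2 fun i => Finset.mem_image_of_mem _ hm
  rw [Set.ncard_eq_toFinset_card T hfin]
  calc (hfin.toFinset.card : ℝ) = ∑ m ∈ hfin.toFinset, (1 : ℝ) := by simp
    _ ≤ ∑ m ∈ hfin.toFinset, Real.exp K * ∏ i, Real.exp (-(x i * |(m i : ℝ)|)) := by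
        refine Finset.sum_le_sum fun m hm => ?_
        rw [← Real.exp_sum, ← Real.exp_add, Finset.sum_neg_distrib]
        exact Real.one_le_exp (by linarith [hT m (hfin.mem_toFinset.1 hm)])
    _ ≤ ∑ m ∈ Fintype.piFinset fun i => hfin.toFinset.image fun m : ι → ℤ => m i,
          Real.exp K * ∏ i, Real.exp (-(x i * |(m i : ℝ)|)) :=
        Finset.sum_le_sum_of_subset_of_nonneg hsub fun m _ _ => by positivity
    _ = Real.exp K * ∏ i, ∑ m ∈ hfin.toFinset.image fun m : ι → ℤ => m i,
          Real.exp (-(x i * |(m : ℝ)|)) := by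
        rw [← Finset.mul_sum, Finset.prod_univ_sum]
    _ ≤ _ := by
        refine mul_le_mul_of_nonneg_left (Finset.prod_le_prod (fun i _ => by positivity)
          fun i _ => sum_exp_neg_abs_le (hx i) (hx1 i) _) (Real.exp_pos _).le

/-- The product of the inverse relative semi-axes is at most exponential in the dimension. -/
lemma prod_ratio_le (J : ℕ) :
    ∏ j : Fin (J + 1), ((J : ℝ) / max (j : ℝ) 1) ≤ Real.exp (2 * J) := by
  have h1 : ∏ j : Fin (J + 1), ((J : ℝ) / max (j : ℝ) 1) = J * ((J : ℝ) ^ J / J.factorial) := by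
    rw [Fin.prod_univ_succ]
    congr 1
    · simp
    · have : ∀ j : Fin J,
          (J : ℝ) / max (((j.succ : Fin (J + 1)) : ℕ) : ℝ) 1 = J / ((j : ℕ) + 1 : ℝ) := fun j => by
          rw [max_eq_left] <;> simp
      simp only [this]
      rw [Finset.prod_div_distrib, Finset.prod_const, Finset.card_univ, Fintype.card_fin,
        Fin.prod_univ_eq_prod_range (fun i => ((i : ℝ) + 1)) J,
        ← Finset.prod_range_add_one_eq_factorial]
      push_cast
      rfl
  rw [h1, two_mul, Real.exp_add]
  refine mul_le_mul ?_ (Real.pow_div_factorial_le_exp _ (Nat.cast_nonneg _) _) (by positivity)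
    (Real.exp_pos _).le
  linarith [Real.add_one_le_exp (J : ℝ)]

/-! ### Nets of the ellipsoids -/

lemma norm_sum_phiLp_sq (A : Finset ℕ) (t : ℕ → ℝ) :
    ‖∑ j ∈ A, t j • phiLp j‖ ^ 2 = ∑ j ∈ A, t j ^ 2 := by
  rw [← real_inner_self_eq_norm_sq, orthonormal_phiLp.inner_sum]
  simp [sq]

lemma inner_sum_phiLp (A : Finset ℕ) (t : ℕ → ℝ) (i : ℕ) :
    inner ℝ (phiLp i) (∑ j ∈ A, t j • phiLp j) = if i ∈ A then t i else 0 := by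
  classical
  split_ifs with h
  · exact orthonormal_phiLp.inner_right_sum t h
  · rw [inner_sum]
    refine Finset.sum_eq_zero fun j hj => ?_
    rw [inner_smul_right, orthonormal_phiLp.2 (fun hij => h (by rwa [hij])), mul_zero]

lemma inner_eq_of_hasSum {θ : ℕ → ℝ} {f : L2One} (h : HasSum (fun j => θ j • phiLp j) f) (i : ℕ) :
    inner ℝ (phiLp i) f = θ i := by
  have := (h.mapL (innerSL ℝ (phiLp i))).unique
    (hasSum_single i fun j hj => by simp [orthonormal_phiLp.2 hj.symm])
  simpa [inner_smul_right, orthonormal_phiLp.1 i] using this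

lemma hasSum_of_mem_ellipsoidClass {w : ℕ → ℝ≥0∞} {L : ℝ} {f : L2One}
    (hf : f ∈ ellipsoidClass w L) : HasSum (fun j => (inner ℝ (phiLp j) f : ℝ) • phiLp j) f := by
  obtain ⟨θ, -, h⟩ := hf
  simpa only [inner_eq_of_hasSum h] using h

/-- Finite cosine polynomials belong to the class as soon as their coefficients obey the
constraint. -/
lemma sum_mem_ellipsoidClass {w : ℕ → ℝ≥0∞} {L : ℝ} (A : Finset ℕ) (t : ℕ → ℝ)
    (h : ∑ j ∈ A, w j ^ 2 * ENNReal.ofReal (t j ^ 2) ≤ ENNReal.ofReal (L ^ 2)) :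
    ∑ j ∈ A, t j • phiLp j ∈ ellipsoidClass w L := by
  classical
  refine ⟨fun j => if j ∈ A then t j else 0, ?_, ?_⟩
  · have hsum : ∑' j, w j ^ 2 * ENNReal.ofReal ((if j ∈ A then t j else 0) ^ 2) =
        ∑ j ∈ A, w j ^ 2 * ENNReal.ofReal ((if j ∈ A then t j else 0) ^ 2) :=
      tsum_eq_sum fun j hj => by simp [hj]
    rw [hsum]
    refine le_trans (le_of_eq (Finset.sum_congr rfl fun j hj => by simp [hj])) h
  · have h1 : HasSum (fun j => (if j ∈ A then t j else 0) • phiLp j)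
        (∑ j ∈ A, (if j ∈ A then t j else 0) • phiLp j) :=
      hasSum_sum_of_ne_finset_zero fun j hj => by simp [hj]
    have h2 : ∑ j ∈ A, (if j ∈ A then t j else 0) • phiLp j = ∑ j ∈ A, t j • phiLp j :=
      Finset.sum_congr rfl fun j hj => by simp [hj]
    exact h2 ▸ h1

lemma truncation_mem_ellipsoidClass {w : ℕ → ℝ≥0∞} {L : ℝ} {f : L2One}
    (hf : f ∈ ellipsoidClass w L) (A : Finset ℕ) :
    ∑ j ∈ A, (inner ℝ (phiLp j) f : ℝ) • phiLp j ∈ ellipsoidClass w L := by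
  obtain ⟨θ, hθ, h⟩ := hf
  simp only [inner_eq_of_hasSum h]
  exact sum_mem_ellipsoidClass A θ ((ENNReal.sum_le_tsum A).trans hθ)

section Nets

variable {w : ℕ → ℝ≥0∞} {L s c : ℝ} (hc : 0 < c)
  (hw : ∀ j : ℕ, ENNReal.ofReal (c * (max (j : ℝ) 1) ^ s) ≤ w j)

include hc hw

/-- The ellipsoid constraint in real numbers. -/
lemma sum_coeff_sq_le {f : L2One} (hf : f ∈ ellipsoidClass w L) (A : Finset ℕ) :
    ∑ j ∈ A, ((max (j : ℝ) 1) ^ s * inner ℝ (phiLp j) f) ^ 2 ≤ (L / c) ^ 2 := by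
  obtain ⟨θ, hθ, h⟩ := hf
  simp only [inner_eq_of_hasSum h]
  have h1 : ∑ j ∈ A, ENNReal.ofReal ((c * ((max (j : ℝ) 1) ^ s * θ j)) ^ 2) ≤
      ENNReal.ofReal (L ^ 2) := by
    refine le_trans (Finset.sum_le_sum fun j _ => ?_) ((ENNReal.sum_le_tsum A).trans hθ)
    rw [← mul_assoc, mul_pow, ENNReal.ofReal_mul (sq_nonneg _),
      ENNReal.ofReal_pow (by positivity)]
    gcongr
    exact hw j
  rw [← ENNReal.ofReal_sum_of_nonneg fun j _ => sq_nonneg _,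
    ENNReal.ofReal_le_ofReal_iff (sq_nonneg _)] at h1
  simp only [mul_pow c, ← Finset.mul_sum] at h1
  rw [div_pow, le_div_iff₀ (by positivity), mul_comm]
  exact h1

/-- Truncation error of the cosine expansion at frequency `J`. -/
lemma norm_sub_truncation_le (hs : 0 < s) (hL : 0 < L) {f : L2One} (hf : f ∈ ellipsoidClass w L)
    (J : ℕ) :
    ‖f - ∑ j ∈ Finset.range J, (inner ℝ (phiLp j) f : ℝ) • phiLp j‖ ≤
      (max (J : ℝ) 1) ^ (-s) * (L / c) := by
  have hlim := ((hasSum_of_mem_ellipsoidClass hf).tendsto_sum_nat.sub_const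
    (∑ j ∈ Finset.range J, (inner ℝ (phiLp j) f : ℝ) • phiLp j)).norm
  refine le_of_tendsto hlim ?_
  filter_upwards [eventually_ge_atTop J] with M hM
  rw [← Finset.sum_Ico_eq_sub _ hM]
  refine abs_le_of_sq_le_sq' ?_ (by positivity) |>.2
  rw [norm_sum_phiLp_sq, mul_pow]
  refine le_trans ?_ (mul_le_mul_of_nonneg_left (sum_coeff_sq_le hc hw hf (Finset.Ico J M))
    (sq_nonneg _))
  rw [Finset.mul_sum]
  refine Finset.sum_le_sum fun j hj => ?_
  rw [← mul_pow, ← mul_assoc, mul_pow]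
  refine le_mul_of_one_le_left (sq_nonneg _) (one_le_pow₀ ?_)
  rw [Real.rpow_neg (by positivity), inv_mul_eq_div, one_le_div (by positivity)]
  refine Real.rpow_le_rpow (by positivity) ?_ hs.le
  exact max_le_max (by exact_mod_cast (Finset.mem_Ico.1 hj).1) le_rfl

lemma norm_le_of_mem_ellipsoidClass (hs : 0 < s) (hL : 0 < L) {f : L2One}
    (hf : f ∈ ellipsoidClass w L) : ‖f‖ ≤ L / c := by
  simpa using norm_sub_truncation_le hc hw hs hL hf 0

/-- Covering number of the ellipsoid at the resolution `δ` at which the truncation error is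
`δ / 2`. The truncated coefficients are rounded to a grid of width `δ / (2 √(J + 1))`. -/
lemma exists_net_aux (hs : 0 < s) (hL : 0 < L) {δ : ℝ} (hδ : 0 < δ) {J : ℕ} (hJ : 0 < J)
    (hJδ : 2 * (L / c) * (J : ℝ) ^ (-s) ≤ δ) :
    ∃ N : Set L2One, N.Finite ∧ N ⊆ ellipsoidClass w L ∧
      (∀ f ∈ ellipsoidClass w L, ∃ φ ∈ N, ‖f - φ‖ ≤ δ) ∧
      (∀ φ ∈ N, ∀ j : ℕ, J < j → inner ℝ (phiLp j) φ = 0) ∧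
      Real.log N.ncard ≤ (6 + 2 * s) * (J + 1) := by
  classical
  have hJ' : (0 : ℝ) < J := by exact_mod_cast hJ
  have hJ1 : (1 : ℝ) ≤ J := by exact_mod_cast hJ
  set η : ℝ := δ / (2 * √(J + 1)) with hη
  have hη0 : 0 < η := by positivity
  set tr : L2One → L2One := fun f =>
    ∑ j ∈ Finset.range (J + 1), (inner ℝ (phiLp j) f : ℝ) • phiLp j with htr
  set G : Set L2One := tr '' ellipsoidClass w L with hG
  set r : L2One → Fin (J + 1) → ℤ := fun g j => ⌊inner ℝ (phiLp j) g / η⌋ with hr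
  have hGF : G ⊆ ellipsoidClass w L := by
    rintro _ ⟨f, hf, rfl⟩
    exact truncation_mem_ellipsoidClass hf _
  have hGtr : ∀ g ∈ G, g = tr g := by
    rintro _ ⟨f, hf, rfl⟩
    simp only [htr]
    refine Finset.sum_congr rfl fun j hj => ?_
    rw [inner_sum_phiLp, if_pos hj]
  -- points with the same rounding are close
  have hclose : ∀ g ∈ G, ∀ g' ∈ G, r g = r g' → ‖g - g'‖ ≤ δ / 2 := by
    intro g hg g' hg' h
    rw [hGtr g hg, hGtr g' hg']
    simp only [htr]
    rw [← Finset.sum_sub_distrib]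
    simp only [← sub_smul]
    refine abs_le_of_sq_le_sq' ?_ (by positivity) |>.2
    rw [norm_sum_phiLp_sq]
    calc _ ≤ ∑ j ∈ Finset.range (J + 1), η ^ 2 := by
          refine Finset.sum_le_sum fun j hj => ?_
          have hj' := congrFun h ⟨j, Finset.mem_range.1 hj⟩
          simp only [hr] at hj'
          have := Int.abs_sub_lt_one_of_floor_eq_floor hj'
          rw [← sub_div, abs_div, abs_of_pos hη0, div_lt_one hη0] at this
          rw [← sq_abs]
          exact pow_le_pow_left₀ (abs_nonneg _) this.le 2
      _ = (δ / 2) ^ 2 := by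
          rw [Finset.sum_const, Finset.card_range, nsmul_eq_mul, hη, div_pow, mul_pow,
            Real.sq_sqrt (by positivity)]
          push_cast
          field_simp
  set x : Fin (J + 1) → ℝ := fun j => (max (j : ℝ) 1 / J) ^ s with hx
  have hx0 : ∀ j, 0 < x j := fun j => by positivity
  have hx1 : ∀ j, x j ≤ 1 := fun j => by
    refine Real.rpow_le_one (by positivity) ?_ hs.le
    rw [div_le_one hJ']
    exact max_le (by exact_mod_cast Nat.lt_succ_iff.1 j.2) hJ1
  -- the rounded coefficients lie in a weighted `ℓ¹` ball, by the Cauchy–Schwarz inequality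
  have hround : ∀ m ∈ r '' G, ∑ i, x i * |(m i : ℝ)| ≤ 2 * (J + 1) := by
    rintro _ ⟨g, hg, rfl⟩
    have hgF := hGF hg
    have h1 : ∀ i : Fin (J + 1), x i * |((r g i : ℤ) : ℝ)| ≤
        (J : ℝ) ^ (-s) / η * |(max (i : ℝ) 1) ^ s * inner ℝ (phiLp i) g| + 1 := fun i => by
      have hfl : |((r g i : ℤ) : ℝ)| ≤ |inner ℝ (phiLp i) g / η| + 1 := by
        have ha := Int.floor_le (inner ℝ (phiLp i) g / η)
        have hb := Int.lt_floor_add_one (inner ℝ (phiLp i) g / η)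
        rw [abs_le]
        constructor
        · linarith [neg_abs_le (inner ℝ (phiLp i) g / η)]
        · linarith [le_abs_self (inner ℝ (phiLp i) g / η)]
      calc x i * |((r g i : ℤ) : ℝ)| ≤ x i * (|inner ℝ (phiLp i) g / η| + 1) :=
            mul_le_mul_of_nonneg_left hfl (hx0 i).le
        _ ≤ x i * |inner ℝ (phiLp i) g / η| + 1 := by linarith [hx1 i]
        _ = _ := by
            rw [abs_div, abs_of_pos hη0, abs_mul,
              abs_of_pos (by positivity : 0 < (max ((i : ℕ) : ℝ) 1) ^ s),
              show x i = (max ((i : ℕ) : ℝ) 1 / J) ^ s from rfl,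
              Real.div_rpow (by positivity) hJ'.le, Real.rpow_neg hJ'.le]
            ring
    have h2 : ∑ i : Fin (J + 1), |(max ((i : ℕ) : ℝ) 1) ^ s * inner ℝ (phiLp i) g| ≤
        √(J + 1) * (L / c) := by
      refine abs_le_of_sq_le_sq' ?_ (by positivity) |>.2
      refine (sq_sum_le_card_mul_sum_sq).trans ?_
      rw [mul_pow, Real.sq_sqrt (by positivity)]
      simp only [Finset.card_univ, Fintype.card_fin, sq_abs]
      push_cast
      refine mul_le_mul_of_nonneg_left ?_ (by positivity)
      rw [Fin.sum_univ_eq_sum_range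
        (fun i => ((max (i : ℝ) 1) ^ s * inner ℝ (phiLp i) g) ^ 2) (J + 1)]
      exact sum_coeff_sq_le hc hw hgF _
    calc ∑ i, x i * |((r g i : ℤ) : ℝ)| ≤ ∑ i : Fin (J + 1),
          ((J : ℝ) ^ (-s) / η * |(max (i : ℝ) 1) ^ s * inner ℝ (phiLp i) g| + 1) :=
          Finset.sum_le_sum fun i _ => h1 i
      _ = (J : ℝ) ^ (-s) / η * ∑ i : Fin (J + 1),
            |(max ((i : ℕ) : ℝ) 1) ^ s * inner ℝ (phiLp i) g| + (J + 1) := by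
          rw [Finset.sum_add_distrib, ← Finset.mul_sum]
          simp
      _ ≤ (J : ℝ) ^ (-s) / η * (√(J + 1) * (L / c)) + (J + 1) := by
          gcongr
      _ ≤ 2 * (J + 1) := by
          have h3 : (J : ℝ) ^ (-s) / η * (√(J + 1) * (L / c)) =
              2 * (L / c) * (J : ℝ) ^ (-s) / δ * (√(J + 1) ^ 2) := by
            rw [hη]
            field_simp
          have h4 : 2 * (L / c) * (J : ℝ) ^ (-s) / δ ≤ 1 := (div_le_one hδ).2 hJδ
          rw [h3, Real.sq_sqrt (by positivity)]
          nlinarith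
  obtain ⟨hfin, hcard⟩ := ncard_lattice_le hx0 hx1 hround
  have hinv : ∀ m ∈ r '' G, Function.invFunOn r G m ∈ G ∧ r (Function.invFunOn r G m) = m :=
    fun m hm => ⟨Function.invFunOn_mem hm, Function.invFunOn_eq hm⟩
  refine ⟨Function.invFunOn r G '' (r '' G), hfin.image _, ?_, ?_, ?_, ?_⟩
  · rintro _ ⟨m, hm, rfl⟩
    exact hGF (hinv m hm).1
  · intro f hf
    have hg : tr f ∈ G := ⟨f, hf, rfl⟩
    have hm : r (tr f) ∈ r '' G := ⟨_, hg, rfl⟩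
    refine ⟨Function.invFunOn r G (r (tr f)), ⟨_, hm, rfl⟩, ?_⟩
    have h1 := hclose _ hg _ (hinv _ hm).1 (hinv _ hm).2.symm
    have h2 : ‖f - tr f‖ ≤ δ / 2 := by
      refine (norm_sub_truncation_le hc hw hs hL hf (J + 1)).trans ?_
      have : (max ((J + 1 : ℕ) : ℝ) 1) ^ (-s) ≤ (J : ℝ) ^ (-s) := by
        refine Real.rpow_le_rpow_of_nonpos hJ' ?_ (by linarith)
        push_cast
        exact le_max_of_le_left (by linarith)
      have h3 : 0 < L / c := by positivity
      nlinarith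
    calc ‖f - Function.invFunOn r G (r (tr f))‖ =
          ‖(f - tr f) + (tr f - Function.invFunOn r G (r (tr f)))‖ := by rw [sub_add_sub_cancel]
      _ ≤ δ / 2 + δ / 2 := (norm_add_le _ _).trans (add_le_add h2 h1)
      _ = δ := by ring
  · rintro _ ⟨m, hm, rfl⟩ j hj
    rw [hGtr _ (hinv m hm).1]
    simp only [htr]
    rw [inner_sum_phiLp, if_neg]
    simp only [Finset.mem_range]
    omega
  · have hprod : ∏ i, (4 / x i) ≤ Real.exp (2 * (J + 1)) ^ 2 * Real.exp (2 * s * J) := by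
      have h1 : ∀ i, 4 / x i = 4 * ((J : ℝ) / max ((i : ℕ) : ℝ) 1) ^ s := fun i => by
        rw [hx, ← inv_div (max ((i : ℕ) : ℝ) 1) (J : ℝ), Real.inv_rpow (by positivity)]
        ring
      simp only [h1]
      rw [Finset.prod_mul_distrib, Finset.prod_const,
        Real.finsetProd_rpow _ _ fun i _ => by positivity]
      refine mul_le_mul ?_ ?_ (by positivity) (by positivity)
      · rw [← Real.exp_nat_mul, Finset.card_univ, Fintype.card_fin]
        have : (4 : ℝ) ≤ Real.exp 4 := by linarith [Real.add_one_le_exp (4 : ℝ)]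
        calc (4 : ℝ) ^ (J + 1) ≤ Real.exp 4 ^ (J + 1) := pow_le_pow_left₀ (by norm_num) this _
          _ = _ := by
            rw [← Real.exp_nat_mul]
            push_cast
            ring_nf
      · calc (∏ i : Fin (J + 1), ((J : ℝ) / max ((i : ℕ) : ℝ) 1)) ^ s ≤ Real.exp (2 * J) ^ s :=
              Real.rpow_le_rpow (Finset.prod_nonneg fun i _ => by positivity) (prod_ratio_le J)
                hs.le
          _ = _ := by
            rw [← Real.exp_mul]
            ring_nf
    have hle : ((Function.invFunOn r G '' (r '' G)).ncard : ℝ) ≤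
        Real.exp ((6 + 2 * s) * (J + 1)) := by
      calc ((Function.invFunOn r G '' (r '' G)).ncard : ℝ) ≤ (r '' G).ncard := by
            exact_mod_cast Set.ncard_image_le hfin
        _ ≤ Real.exp (2 * (J + 1)) * ∏ i, (4 / x i) := hcard
        _ ≤ Real.exp (2 * (J + 1)) * (Real.exp (2 * (J + 1)) ^ 2 * Real.exp (2 * s * J)) := by
            gcongr
        _ = Real.exp (6 * (J + 1) + 2 * s * J) := by
            rw [← Real.exp_nat_mul, ← Real.exp_add, ← Real.exp_add]
            push_cast
            ring_nf
        _ ≤ _ := Real.exp_le_exp.2 (by nlinarith)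
    rcases Nat.eq_zero_or_pos (Function.invFunOn r G '' (r '' G)).ncard with h0 | h0
    · rw [h0]
      simp
      positivity
    · rw [Real.log_le_iff_le_exp (by exact_mod_cast h0)]
      exact hle

lemma exists_isNetFamily (hs : 0 < s) (hL : 0 < L) :
    ∃ N : ℝ → Set L2One, IsNetFamily s (ellipsoidClass w L) N := by
  set R := L / c with hR
  have hR0 : 0 < R := by positivity
  set B : ℝ := (2 * R) ^ (1 / s) + 2 * R ^ (1 / s) with hB
  have hB0 : 0 < B := by positivity
  set C : ℝ := (6 + 2 * s) * B with hC
  have hC0 : 0 < C := by positivity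
  suffices h : ∀ δ : ℝ, ∃ N : Set L2One, 0 < δ → (N.Finite ∧ N ⊆ ellipsoidClass w L ∧
      (∀ f ∈ ellipsoidClass w L, ∃ φ ∈ N, ‖f - φ‖ ≤ δ) ∧
      (∀ φ ∈ N, ∀ j : ℕ, C * δ ^ (-1 / s) < j → inner ℝ (phiLp j) φ = 0) ∧
      Real.log N.ncard ≤ C * δ ^ (-1 / s)) by
    choose N hN using h
    exact ⟨N, C, hC0, hN⟩
  intro δ
  -- for `δ` at least the radius `R` of the class, the net consists of the zero function
  rcases le_or_gt R δ with hδ | hδ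
  · refine ⟨{0}, fun hδ0 => ⟨Set.finite_singleton _, ?_, fun f hf => ⟨0, rfl, ?_⟩, ?_, ?_⟩⟩
    · rw [Set.singleton_subset_iff]
      simpa using sum_mem_ellipsoidClass (w := w) (L := L) ∅ 0 (by simp)
    · rw [sub_zero]
      exact (norm_le_of_mem_ellipsoidClass hc hw hs hL hf).trans hδ
    · rintro φ rfl j -
      exact inner_zero_right _
    · simp
      positivity
  · rcases le_or_gt δ 0 with hδ0 | hδ0
    · exact ⟨∅, fun h => absurd h (not_lt.2 hδ0)⟩
    set J : ℕ := ⌈(2 * R / δ) ^ (1 / s)⌉₊ with hJdef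
    have hpos : 0 < (2 * R / δ) ^ (1 / s) := by positivity
    have hJ : 0 < J := Nat.ceil_pos.2 hpos
    have hJ' : (0 : ℝ) < J := by exact_mod_cast hJ
    have hJge : (2 * R / δ) ^ (1 / s) ≤ J := Nat.le_ceil _
    have hJlt : (J : ℝ) < (2 * R / δ) ^ (1 / s) + 1 := Nat.ceil_lt_add_one hpos.le
    have hJδ : 2 * (L / c) * (J : ℝ) ^ (-s) ≤ δ := by
      have h1 : 2 * R / δ ≤ (J : ℝ) ^ s := by
        have := Real.rpow_le_rpow hpos.le hJge hs.le
        rwa [← Real.rpow_mul (by positivity), one_div_mul_cancel hs.ne', Real.rpow_one] at this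
      rw [Real.rpow_neg hJ'.le, ← hR, ← div_eq_mul_inv, div_le_iff₀ (by positivity)]
      rw [div_le_iff₀ hδ0] at h1
      linarith
    have hδpow : δ ^ (-1 / s) = (δ ^ (1 / s))⁻¹ := by
      rw [neg_div, Real.rpow_neg hδ0.le]
    have hJB : (J : ℝ) + 1 ≤ B * δ ^ (-1 / s) := by
      have h1 : 1 ≤ R ^ (1 / s) * δ ^ (-1 / s) := by
        rw [hδpow, ← div_eq_mul_inv, ← Real.div_rpow hR0.le hδ0.le]
        exact Real.one_le_rpow ((one_le_div hδ0).2 hδ.le) (by positivity)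
      have h2 : (2 * R / δ) ^ (1 / s) = (2 * R) ^ (1 / s) * δ ^ (-1 / s) := by
        rw [hδpow, ← div_eq_mul_inv, Real.div_rpow (by positivity) hδ0.le]
      rw [hB, add_mul, ← h2]
      linarith
    have hJC : (6 + 2 * s) * ((J : ℝ) + 1) ≤ C * δ ^ (-1 / s) := by
      rw [hC, mul_assoc]
      exact mul_le_mul_of_nonneg_left hJB (by positivity)
    obtain ⟨N, h1, h2, h3, h4, h5⟩ := exists_net_aux hc hw hs hL hδ0 hJ hJδ
    refine ⟨N, fun _ => ⟨h1, h2, h3, fun φ hφ j hj => h4 φ hφ j ?_, h5.trans hJC⟩⟩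
    have : (J : ℝ) < j := by nlinarith
    exact_mod_cast this

end Nets

/-- The hypotheses on the weights give a lower bound `c (j ∨ 1)^s` including the frequency `0`. -/
lemma exists_weight_lower_bound {w : ℕ → ℝ≥0∞} {s C₀ : ℝ} (hC₀ : 0 < C₀) (hw₀ : 0 < w 0)
    (hw : ∀ j : ℕ, 1 ≤ j → ENNReal.ofReal (C₀ * (j : ℝ) ^ s) ≤ w j) :
    ∃ c > 0, ∀ j : ℕ, ENNReal.ofReal (c * (max (j : ℝ) 1) ^ s) ≤ w j := by
  obtain ⟨c₁, hc₁, hle⟩ : ∃ c₁ > 0, ENNReal.ofReal c₁ ≤ w 0 := by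
    obtain ⟨r, hr, hr2⟩ := ENNReal.lt_iff_exists_real_btwn.1 hw₀
    exact ⟨r, ENNReal.ofReal_pos.1 hr2.1, hr2.2.le⟩
  refine ⟨min C₀ c₁, lt_min hC₀ hc₁, fun j => ?_⟩
  rcases Nat.eq_zero_or_pos j with rfl | hj
  · refine le_trans (ENNReal.ofReal_le_ofReal ?_) hle
    simp
  · refine le_trans (ENNReal.ofReal_le_ofReal ?_) (hw j hj)
    rw [max_eq_left (by exact_mod_cast hj)]
    exact mul_le_mul_of_nonneg_right (min_le_left _ _) (by positivity)

section

variable {d : ℕ}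

/-! ### The upper bound -/

lemma additiveClass_eq_image (S : Fin d → Set L2One) :
    additiveClass S = (fun g : Fin d → L2One => ∑ k, lift k (g k)) '' {g | ∀ k, g k ∈ S k} := by
  ext f
  constructor
  · rintro ⟨g, hg, rfl⟩
    exact ⟨g, hg, rfl⟩
  · rintro ⟨g, hg, rfl⟩
    exact ⟨g, hg, rfl⟩

lemma finite_additiveClass {S : Fin d → Set L2One} (hS : ∀ k, (S k).Finite) :
    (additiveClass S).Finite := by
  rw [additiveClass_eq_image]
  exact (Set.Finite.pi' hS).image _

/-- Componentwise approximation gives approximation of the sum. -/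
lemma exists_additiveClass_close {F N : Fin d → Set L2One} {δ : Fin d → ℝ}
    (h : ∀ k, ∀ f ∈ F k, ∃ φ ∈ N k, ‖f - φ‖ ≤ δ k) {f : L2Torus d} (hf : f ∈ additiveClass F) :
    ∃ g ∈ additiveClass N, ‖g - f‖ ≤ ∑ k, δ k := by
  obtain ⟨u, hu, rfl⟩ := hf
  choose φ hφ1 hφ2 using fun k => h k (u k) (hu k)
  refine ⟨_, ⟨φ, hφ1, rfl⟩, ?_⟩
  rw [norm_sub_rev, ← Finset.sum_sub_distrib]
  refine (norm_sum_le _ _).trans (Finset.sum_le_sum fun k _ => ?_)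
  rw [← liftₗᵢ_apply, ← liftₗᵢ_apply, ← map_sub, LinearIsometry.norm_map]
  exact hφ2 k

/-- The indices of the basis functions of frequency at most `J k` in the `k`th coordinate. -/
def freqIndex (J : Fin d → ℕ) : Finset (Option (Fin d × ℕ)) :=
  Finset.insertNone ((Finset.univ.sigma fun k => Finset.range (J k)).map
    (Equiv.sigmaEquivProd (Fin d) ℕ).toEmbedding)

lemma sum_freqIndex (J : Fin d → ℕ) (g : Option (Fin d × ℕ) → ℝ) :
    ∑ i ∈ freqIndex J, g i = g none + ∑ k, ∑ j ∈ Finset.range (J k), g (some (k, j)) := by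
  rw [freqIndex, Finset.sum_insertNone, Finset.sum_map, Finset.sum_sigma]
  rfl

lemma some_mem_freqIndex {J : Fin d → ℕ} {k : Fin d} {j : ℕ} (h : j < J k) :
    some (k, j) ∈ freqIndex J := by
  rw [freqIndex, Finset.some_mem_insertNone, Finset.mem_map]
  exact ⟨⟨k, j⟩, by simpa using h, rfl⟩

lemma lift_mem_span (k₀ k : Fin d) {w : ℕ → ℝ≥0∞} {L : ℝ} {g : L2One}
    (hg : g ∈ ellipsoidClass w L) (J : Fin d → ℕ)
    (hJ : ∀ j, J k < j → inner ℝ (phiLp j) g = 0) :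
    lift k g ∈ Submodule.span ℝ (addBasis k₀ '' (freqIndex J : Set (Option (Fin d × ℕ)))) := by
  have h1 : g = ∑ j ∈ Finset.range (J k + 1), (inner ℝ (phiLp j) g : ℝ) • phiLp j :=
    (hasSum_of_mem_ellipsoidClass hg).unique
      (hasSum_sum_of_ne_finset_zero fun j hj => by
        rw [hJ j (by rw [Finset.mem_range] at hj; omega), zero_smul])
  rw [h1, ← liftₗᵢ_apply, map_sum]
  refine Submodule.sum_mem _ fun j hj => ?_
  rw [map_smul, liftₗᵢ_apply]
  refine Submodule.smul_mem _ _ (Submodule.subset_span ?_)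
  rcases j with _ | j
  · exact ⟨none, by simp [freqIndex], lift_phiLp_zero _ _⟩
  · exact ⟨some (k, j), some_mem_freqIndex (by simpa using hj), rfl⟩

lemma additiveClass_subset_span (k₀ : Fin d) {w : Fin d → ℕ → ℝ≥0∞} {L : Fin d → ℝ}
    {N : Fin d → Set L2One} (hN : ∀ k, N k ⊆ ellipsoidClass (w k) (L k)) (J : Fin d → ℕ)
    (hJ : ∀ k, ∀ φ ∈ N k, ∀ j, J k < j → inner ℝ (phiLp j) φ = 0) :
    additiveClass N ⊆
      Submodule.span ℝ (addBasis k₀ '' (freqIndex J : Set (Option (Fin d × ℕ)))) := by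
  rintro _ ⟨g, hg, rfl⟩
  exact Submodule.sum_mem _ fun k _ => lift_mem_span k₀ k (hN k (hg k)) J (hJ k _ (hg k))

/-- The variance term of one coordinate. -/
lemma sum_inv_eig_sq_le {b : ℕ → ℝ} {q C₂ : ℝ} (hq : 0 ≤ q) (hC₂ : 0 < C₂)
    (hb : ∀ j : ℕ, 1 ≤ j → C₂ * (j : ℝ) ^ (-q) ≤ b j) {J : ℕ} {x : ℝ} (hx : (J : ℝ) ≤ x) :
    ∑ j ∈ Finset.range J, (eig b (j + 1) ^ 2)⁻¹ ≤ 2 / C₂ ^ 2 * x ^ (2 * q + 1) := by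
  have hx0 : 0 ≤ x := (Nat.cast_nonneg J).trans hx
  have hterm : ∀ j ∈ Finset.range J, (eig b (j + 1) ^ 2)⁻¹ ≤ 2 / C₂ ^ 2 * x ^ (2 * q) := by
    intro j hj
    have hj1 : ((j + 1 : ℕ) : ℝ) ≤ x :=
      le_trans (by exact_mod_cast Finset.mem_range.1 hj) hx
    have hj0 : (0 : ℝ) < ((j + 1 : ℕ) : ℝ) := by positivity
    have h1 := hb (j + 1) (by omega)
    rw [eig, if_neg (by omega), div_pow, Real.sq_sqrt (by norm_num), inv_div]
    have h2 : (C₂ * ((j + 1 : ℕ) : ℝ) ^ (-q)) ^ 2 ≤ b (j + 1) ^ 2 :=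
      pow_le_pow_left₀ (by positivity) h1 2
    have h3 : (C₂ * ((j + 1 : ℕ) : ℝ) ^ (-q)) ^ 2 = C₂ ^ 2 / ((j + 1 : ℕ) : ℝ) ^ (2 * q) := by
      rw [mul_pow, ← Real.rpow_natCast (((j + 1 : ℕ) : ℝ) ^ (-q)), ← Real.rpow_mul hj0.le,
        div_eq_mul_inv, ← Real.rpow_neg hj0.le]
      congr 2
      push_cast
      ring
    calc 2 / b (j + 1) ^ 2 ≤ 2 / (C₂ ^ 2 / ((j + 1 : ℕ) : ℝ) ^ (2 * q)) := by
          rw [← h3]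
          exact div_le_div_of_nonneg_left (by norm_num) (by positivity) h2
      _ = 2 / C₂ ^ 2 * ((j + 1 : ℕ) : ℝ) ^ (2 * q) := by
          field_simp
      _ ≤ _ := by
          gcongr
  calc _ ≤ ∑ j ∈ Finset.range J, 2 / C₂ ^ 2 * x ^ (2 * q) := Finset.sum_le_sum hterm
    _ = J * (2 / C₂ ^ 2 * x ^ (2 * q)) := by simp
    _ ≤ x * (2 / C₂ ^ 2 * x ^ (2 * q)) := by gcongr
    _ = 2 / C₂ ^ 2 * x ^ (2 * q + 1) := by
        rw [Real.rpow_add_one' hx0 (by positivity)]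
        ring

/-- The exponents balance: at the cut-off frequency the variance is of the order of the squared
bias. -/
lemma variance_rate {s q K c δ n : ℝ} (hs : 0 < s) (hq : 0 ≤ q) (hK : 0 < K) (hc : 0 < c)
    (hn : 1 ≤ n) (hδ : c * n ^ (-(s / (2 * s + 2 * q + 1))) ≤ δ) :
    n⁻¹ * (K * δ ^ (-1 / s)) ^ (2 * q + 1) ≤
      (K * c ^ (-1 / s)) ^ (2 * q + 1) * n ^ (-(2 * s / (2 * s + 2 * q + 1))) := by
  have hn0 : 0 < n := by linarith
  set D := 2 * s + 2 * q + 1 with hD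
  have hD0 : 0 < D := by positivity
  have hlow : 0 < c * n ^ (-(s / D)) := by positivity
  have h1 : δ ^ (-1 / s) ≤ c ^ (-1 / s) * n ^ (1 / D) := by
    calc δ ^ (-1 / s) ≤ (c * n ^ (-(s / D))) ^ (-1 / s) :=
          Real.rpow_le_rpow_of_nonpos hlow hδ (by rw [neg_div]; simp; positivity)
      _ = _ := by
          rw [Real.mul_rpow hc.le (by positivity), ← Real.rpow_mul hn0.le]
          congr 2
          field_simp
  calc n⁻¹ * (K * δ ^ (-1 / s)) ^ (2 * q + 1) ≤
        n⁻¹ * (K * (c ^ (-1 / s) * n ^ (1 / D))) ^ (2 * q + 1) := by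
        have : 0 ≤ δ := hlow.le.trans hδ
        gcongr
    _ = (K * c ^ (-1 / s)) ^ (2 * q + 1) * (n⁻¹ * n ^ (1 / D * (2 * q + 1))) := by
        rw [← mul_assoc K, Real.mul_rpow (by positivity) (by positivity), ← Real.rpow_mul hn0.le]
        ring
    _ = _ := by
        rw [← Real.rpow_neg_one, ← Real.rpow_add hn0]
        congr 2
        rw [hD]
        field_simp
        ring

variable {Ω : Type*} [MeasurableSpace Ω] {P : Measure Ω} [IsProbabilityMeasure P]
  {W : L2Torus d → Ω → ℝ}

/-- The net estimators exist and attain the rate `n^{-α}`, whenever `α` is at most the exponent of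
each coordinate. -/
theorem net_estimator_rate (k₀ : Fin d) {s q L : Fin d → ℝ} (hs : ∀ k, 0 < s k)
    (hq : ∀ k, 0 ≤ q k) (w : Fin d → ℕ → ℝ≥0∞)
    {a : UnitAddTorus (Fin d) → ℝ} (ha : Integrable a)
    (hak : ∀ k, MemLp (marginal a k) 2) {b : Fin d → ℕ → ℝ}
    (hb : ∀ k, HasSum (fun j => b k j • phiLp j) (hak k).toLp)
    {C₂ : ℝ} (hC₂ : 0 < C₂) (hb₀ : ∀ k, 0 < b k 0)
    (hbj : ∀ k, ∀ j : ℕ, 1 ≤ j → C₂ * (j : ℝ) ^ (-q k) ≤ b k j)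
    (hW : IsWhiteNoise P W) {α : ℝ}
    (hα : ∀ k, α ≤ 2 * s k / (2 * s k + 2 * q k + 1))
    {N : Fin d → ℝ → Set L2One}
    (hN : ∀ k, IsNetFamily (s k) (ellipsoidClass (w k) (L k)) (N k))
    {δ : Fin d → ℕ → ℝ}
    (hδ : ∃ c > 0, ∃ C > 0, ∀ k, ∀ n : ℕ, 1 ≤ n →
      c * (n : ℝ) ^ (-(s k / (2 * s k + 2 * q k + 1))) ≤ δ k n ∧
      δ k n ≤ C * (n : ℝ) ^ (-(s k / (2 * s k + 2 * q k + 1)))) :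
    (∃ fhat : ℕ → (L2Torus d → ℝ) → L2Torus d,
      ∀ n, 1 ≤ n → IsMinimizerOver a (additiveClass fun k => N k (δ k n)) (fhat n)) ∧
    ∀ fhat : ℕ → (L2Torus d → ℝ) → L2Torus d,
      (∀ n, 1 ≤ n → IsMinimizerOver a (additiveClass fun k => N k (δ k n)) (fhat n)) →
      limsup (fun n : ℕ => ENNReal.ofReal ((n : ℝ) ^ α) *
        ⨆ f ∈ additiveClass fun k => ellipsoidClass (w k) (L k),
          mise P a W n (fhat n) f) atTop < ⊤ := by
  classical
  obtain ⟨c, hc, C, hC, hδ⟩ := hδ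
  choose K hK hN using hN
  have hδ0 : ∀ k n, 1 ≤ n → 0 < δ k n := fun k n hn => by
    have : (0 : ℝ) < n := by exact_mod_cast hn
    exact lt_of_lt_of_le (by positivity) (hδ k n hn).1
  have hfin : ∀ n, 1 ≤ n → (additiveClass fun k => N k (δ k n)).Finite := fun n hn =>
    finite_additiveClass fun k => (hN k _ (hδ0 k n hn)).1
  have hclose : ∀ n, 1 ≤ n → ∀ f ∈ additiveClass fun k => ellipsoidClass (w k) (L k),
      ∃ g ∈ additiveClass fun k => N k (δ k n), ‖g - f‖ ≤ ∑ k, δ k n := fun n hn f hf =>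
    exists_additiveClass_close (fun k => (hN k _ (hδ0 k n hn)).2.2.1) hf
  refine ⟨?_, fun fhat hfhat => ?_⟩
  · have : ∀ n, ∃ fhat, 1 ≤ n → IsMinimizerOver a (additiveClass fun k => N k (δ k n)) fhat := by
      intro n
      by_cases hn : 1 ≤ n
      · have hne : (additiveClass fun k => N k (δ k n)).Nonempty := by
          have h0 : (∑ k, lift k (0 : L2One)) ∈
              additiveClass fun k => ellipsoidClass (w k) (L k) :=
            ⟨fun _ => 0, fun k => by
              simpa using sum_mem_ellipsoidClass (w := w k) (L := L k) ∅ 0 (by simp), rfl⟩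
          obtain ⟨g, hg, -⟩ := hclose n hn _ h0
          exact ⟨g, hg⟩
        obtain ⟨fhat, h⟩ := exists_isMinimizerOver a (hfin n hn) hne
        exact ⟨fhat, fun _ => h⟩
      · exact ⟨fun _ => 0, fun h => absurd h hn⟩
    choose fhat hfhat using this
    exact ⟨fhat, hfhat⟩
  · have hpos : ∀ k j, 0 < b k j := fun k j => by
      rcases Nat.eq_zero_or_pos j with rfl | hj
      · exact hb₀ k
      · have : (0 : ℝ) < j := by exact_mod_cast hj
        exact lt_of_lt_of_le (by positivity) (hbj k j hj)
    set M : ℝ := 4 * (d * ∑ _k : Fin d, C ^ 2) + 6 * ((b k₀ 0 ^ 2)⁻¹ +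
      ∑ k, 2 / C₂ ^ 2 * (K k * c ^ (-1 / s k)) ^ (2 * q k + 1)) with hM
    have hbound : ∀ n : ℕ, 1 ≤ n → ∀ f ∈ additiveClass fun k => ellipsoidClass (w k) (L k),
        mise P a W n (fhat n) f ≤ ENNReal.ofReal (M * (n : ℝ) ^ (-α)) := by
      intro n hn f hf
      have hn1 : (1 : ℝ) ≤ n := by exact_mod_cast hn
      have hn0 : (0 : ℝ) < n := by linarith
      have hrate : ∀ k, (n : ℝ) ^ (-(2 * s k / (2 * s k + 2 * q k + 1))) ≤ (n : ℝ) ^ (-α) :=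
        fun k => Real.rpow_le_rpow_of_exponent_le hn1 (neg_le_neg (hα k))
      have hninv : (n : ℝ)⁻¹ ≤ (n : ℝ) ^ (-α) := by
        rw [← Real.rpow_neg_one]
        refine Real.rpow_le_rpow_of_exponent_le hn1 (neg_le_neg ((hα k₀).trans ?_))
        have := hs k₀
        have := hq k₀
        rw [div_le_one (by positivity)]
        linarith
      obtain ⟨g₀, hg₀, hg₀f⟩ := hclose n hn f hf
      set J : Fin d → ℕ := fun k => ⌊K k * δ k n ^ (-1 / s k)⌋₊ with hJ
      have hJle : ∀ k, (J k : ℝ) ≤ K k * δ k n ^ (-1 / s k) := fun k =>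
        Nat.floor_le (mul_nonneg (hK k).le (Real.rpow_nonneg (hδ0 k n hn).le _))
      have hspan := additiveClass_subset_span k₀ (w := w) (L := L) (N := fun k => N k (δ k n))
        (fun k => (hN k _ (hδ0 k n hn)).2.1) J
        fun k φ hφ j hj => (hN k _ (hδ0 k n hn)).2.2.2.1 φ hφ j (Nat.lt_of_floor_lt hj)
      refine (mise_le ha hak hb hpos k₀ hW (hfin n hn) (freqIndex J) hspan (hfhat n hn)
        hg₀ f).trans (ENNReal.ofReal_le_ofReal ?_)
      have hbias : ‖g₀ - f‖ ^ 2 ≤ d * ∑ _k : Fin d, C ^ 2 * (n : ℝ) ^ (-α) := by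
        calc ‖g₀ - f‖ ^ 2 ≤ (∑ k, δ k n) ^ 2 := pow_le_pow_left₀ (norm_nonneg _) hg₀f 2
          _ ≤ d * ∑ k, δ k n ^ 2 := by
              have := sq_sum_le_card_mul_sum_sq (s := Finset.univ) (f := fun k => δ k n)
              simpa using this
          _ ≤ _ := by
              refine mul_le_mul_of_nonneg_left (Finset.sum_le_sum fun k _ => ?_)
                (Nat.cast_nonneg d)
              calc δ k n ^ 2 ≤ (C * (n : ℝ) ^ (-(s k / (2 * s k + 2 * q k + 1)))) ^ 2 :=
                    pow_le_pow_left₀ (hδ0 k n hn).le (hδ k n hn).2 2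
                _ = C ^ 2 * (n : ℝ) ^ (-(2 * s k / (2 * s k + 2 * q k + 1))) := by
                    rw [mul_pow, ← Real.rpow_natCast ((n : ℝ) ^ _), ← Real.rpow_mul hn0.le]
                    congr 2
                    push_cast
                    ring
                _ ≤ _ := mul_le_mul_of_nonneg_left (hrate k) (sq_nonneg C)
      have hvar : (n : ℝ)⁻¹ * ∑ i ∈ freqIndex J, (addEig k₀ b i ^ 2)⁻¹ ≤
          ((b k₀ 0 ^ 2)⁻¹ + ∑ k, 2 / C₂ ^ 2 * (K k * c ^ (-1 / s k)) ^ (2 * q k + 1)) *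
            (n : ℝ) ^ (-α) := by
        rw [sum_freqIndex, mul_add, add_mul]
        refine add_le_add ?_ ?_
        · rw [mul_comm]
          simp only [addEig, eig, if_true]
          exact mul_le_mul_of_nonneg_left hninv (by positivity)
        · rw [Finset.mul_sum, Finset.sum_mul]
          refine Finset.sum_le_sum fun k _ => ?_
          have hKk := hK k
          calc (n : ℝ)⁻¹ * ∑ j ∈ Finset.range (J k), (addEig k₀ b (some (k, j)) ^ 2)⁻¹ ≤
                (n : ℝ)⁻¹ * (2 / C₂ ^ 2 * (K k * δ k n ^ (-1 / s k)) ^ (2 * q k + 1)) :=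
                mul_le_mul_of_nonneg_left
                  (sum_inv_eig_sq_le (hq k) hC₂ (hbj k) (hJle k)) (by positivity)
            _ = 2 / C₂ ^ 2 * ((n : ℝ)⁻¹ * (K k * δ k n ^ (-1 / s k)) ^ (2 * q k + 1)) := by ring
            _ ≤ 2 / C₂ ^ 2 * ((K k * c ^ (-1 / s k)) ^ (2 * q k + 1) * (n : ℝ) ^ (-α)) := by
                refine mul_le_mul_of_nonneg_left ?_ (by positivity)
                refine (variance_rate (hs k) (hq k) hKk hc hn1 (hδ k n hn).1).trans ?_
                exact mul_le_mul_of_nonneg_left (hrate k) (by positivity)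
            _ = _ := by ring
      rw [← Finset.sum_mul] at hbias
      rw [hM]
      calc _ ≤ 4 * (d * ((∑ _k : Fin d, C ^ 2) * (n : ℝ) ^ (-α))) + 6 * (((b k₀ 0 ^ 2)⁻¹ +
            ∑ k, 2 / C₂ ^ 2 * (K k * c ^ (-1 / s k)) ^ (2 * q k + 1)) * (n : ℝ) ^ (-α)) := by
            linarith
        _ = _ := by ring
    refine lt_of_le_of_lt (limsup_le_of_le (h := ?_) : _ ≤ ENNReal.ofReal M) ENNReal.ofReal_lt_top
    filter_upwards [eventually_ge_atTop 1] with n hn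
    have hn0 : (0 : ℝ) < n := by exact_mod_cast hn
    calc _ ≤ ENNReal.ofReal ((n : ℝ) ^ α) * ENNReal.ofReal (M * (n : ℝ) ^ (-α)) := by
          gcongr
          exact iSup₂_le fun f hf => hbound n hn f hf
      _ = ENNReal.ofReal M := by
          rw [← ENNReal.ofReal_mul (by positivity), mul_left_comm, ← Real.rpow_add hn0,
            add_neg_cancel, Real.rpow_zero, mul_one]

end

section

variable {d : ℕ}

/-! ### The lower bound -/

/-- The function `∑_{j ∈ A} ± τ φ_j(x_k)` with sign `+` for `j ∈ B` and `-` otherwise, a vertex of a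
hypercube. -/
def cubeVertex (k : Fin d) (A : Finset ℕ) (τ : ℝ) (B : Finset ℕ) : L2Torus d :=
  lift k (∑ j ∈ A, (if j ∈ B then τ else -τ) • phiLp j)

lemma inner_cubeVertex (k : Fin d) {A : Finset ℕ} (τ : ℝ) (B : Finset ℕ) {j : ℕ} (hj : j ∈ A) :
    inner ℝ (lift k (phiLp j)) (cubeVertex k A τ B) = if j ∈ B then τ else -τ := by
  rw [cubeVertex, inner_lift_lift_self, inner_sum_phiLp, if_pos hj]

variable {Ω : Type*} {W : L2Torus d → Ω → ℝ}

section Measurability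

variable [MeasurableSpace Ω] {P : Measure Ω}

lemma measurable_observation (a : UnitAddTorus (Fin d) → ℝ) (hW : IsWhiteNoise P W) (n : ℕ)
    (f : L2Torus d) : Measurable (observation a W n f) :=
  measurable_pi_lambda _ fun h => ((hW.measurable h).const_mul _).const_add _

lemma IsEstimator.measurable_inner {ghat : (L2Torus d → ℝ) → L2Torus d} (hg : IsEstimator ghat)
    (e : L2Torus d) : Measurable fun y => inner ℝ e (ghat y) := by
  let _ : MeasurableSpace (L2Torus d) := borel (L2Torus d)
  have : BorelSpace (L2Torus d) := ⟨rfl⟩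
  have h : Measurable fun x : L2Torus d => (inner ℝ e x : ℝ) :=
    (continuous_const.inner continuous_id).measurable
  exact h.comp hg

end Measurability

section Cube

variable {a : UnitAddTorus (Fin d) → ℝ} (ha : Integrable a)
  (hak : ∀ k, MemLp (marginal a k) 2) {b : Fin d → ℕ → ℝ}
  (hb : ∀ k, HasSum (fun j => b k j • phiLp j) (hak k).toLp)

include ha hb

/-- The observation under a vertex, split into the coordinate `j` and the rest. -/
lemma observation_cubeVertex (k : Fin d) {A : Finset ℕ} (τ : ℝ) (B : Finset ℕ) {j : ℕ}
    (hj : j ∈ A) (n : ℕ) (ω : Ω) (h : L2Torus d) :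
    observation a W n (cubeVertex k A τ B) ω h =
      (∑ i ∈ A.erase j, (if i ∈ B then τ else -τ) * eig (b k) i * inner ℝ (lift k (phiLp i)) h) +
      (if j ∈ B then τ else -τ) * eig (b k) j * inner ℝ (lift k (phiLp j)) h +
      (√(n : ℝ))⁻¹ * W h ω := by
  rw [observation, cubeVertex, integral_conv_lift_sum ha hak hb, ← Finset.add_sum_erase A _ hj]
  ring

variable [MeasurableSpace Ω] {P : Measure Ω} [IsProbabilityMeasure P]

/-- Assouad's lemma on the hypercube of vertices: the maximal risk is at least the number of
coordinates times the two-point bound. -/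
lemma assouad_bound (hW : IsWhiteNoise P W) (k : Fin d) (A : Finset ℕ) {τ : ℝ} (hτ : 0 ≤ τ)
    {n : ℕ} (hn : 1 ≤ n) (hpos : ∀ j ∈ A, 0 ≤ eig (b k) j)
    (hμ : ∀ j ∈ A, τ * eig (b k) j ≤ (√(n : ℝ))⁻¹)
    {ghat : (L2Torus d → ℝ) → L2Torus d} (hg : IsEstimator ghat) {R : ℝ≥0∞}
    (hR : ∀ B ∈ A.powerset, mise P a W n ghat (cubeVertex k A τ B) ≤ R) :
    ENNReal.ofReal (A.card * (Real.exp (-1) / √2 * τ ^ 2)) ≤ R := by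
  classical
  have hn0 : (0 : ℝ) < n := by exact_mod_cast hn
  set e : ℕ → L2Torus d := fun j => lift k (phiLp j)
  have hon : Orthonormal ℝ e := orthonormal_phiLp.comp_linearIsometry (liftₗᵢ k)
  -- the risk for coordinate `j`
  set r : ℕ → Finset ℕ → ℝ≥0∞ := fun j B => ∫⁻ ω, ENNReal.ofReal
    ((inner ℝ (e j) (ghat (observation a W n (cubeVertex k A τ B) ω)) -
      (if j ∈ B then τ else -τ)) ^ 2) ∂P with hr
  have hmeas : ∀ j B, Measurable fun ω =>
      (inner ℝ (e j) (ghat (observation a W n (cubeVertex k A τ B) ω)) : ℝ) := fun j B =>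
    (hg.measurable_inner (e j)).comp (measurable_observation a hW n _)
  have hmise : ∀ B, ∑ j ∈ A, r j B ≤ mise P a W n ghat (cubeVertex k A τ B) := fun B => by
    simp only [hr]
    rw [← lintegral_finsetSum _ fun j _ => by
      exact ((hmeas j B).sub_const _).pow_const 2 |>.ennreal_ofReal]
    refine lintegral_mono fun ω => ?_
    rw [← ENNReal.ofReal_sum_of_nonneg fun j _ => sq_nonneg _]
    refine ENNReal.ofReal_le_ofReal ?_
    have := hon.sum_inner_products_le
      (ghat (observation a W n (cubeVertex k A τ B) ω) - cubeVertex k A τ B) (s := A)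
    refine le_trans (le_of_eq (Finset.sum_congr rfl fun j hj => ?_)) this
    rw [inner_sub_right, inner_cubeVertex k τ B hj, Real.norm_eq_abs, sq_abs]
  -- neighbouring vertices differ in the sign of the coordinate `j` only
  have hpair : ∀ j ∈ A, ∀ B ∈ (A.erase j).powerset,
      ENNReal.ofReal (Real.exp (-1) / √2) * ENNReal.ofReal (2 * τ ^ 2) ≤
        r j B + r j (insert j B) := by
    intro j hj B hB
    have hjB : j ∉ B := fun h => Finset.notMem_erase j A (Finset.mem_powerset.1 hB h)
    have h := hW.two_point (e := e j) (hon.1 j)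
      (fun h => ∑ i ∈ A.erase j, (if i ∈ B then τ else -τ) * eig (b k) i *
        inner ℝ (lift k (phiLp i)) h)
      (σ := (√(n : ℝ))⁻¹) (μ := τ * eig (b k) j) (by positivity)
      (by rw [abs_of_nonneg (mul_nonneg hτ (hpos j hj))]; exact hμ j hj) τ
      (hg.measurable_inner (e j))
    rw [add_comm (r j B)]
    refine h.trans (le_of_eq ?_)
    simp only [hr]
    congr 1
    · refine lintegral_congr fun ω => ?_
      have : observation a W n (cubeVertex k A τ (insert j B)) ω = fun h =>
          ∑ i ∈ A.erase j, (if i ∈ B then τ else -τ) * eig (b k) i *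
            inner ℝ (lift k (phiLp i)) h + τ * eig (b k) j * inner ℝ (e j) h +
            (√(n : ℝ))⁻¹ * W h ω := by
        ext h
        rw [observation_cubeVertex ha hak hb k τ _ hj, if_pos (Finset.mem_insert_self j B)]
        congr 2
        refine Finset.sum_congr rfl fun i hi => ?_
        simp [Finset.ne_of_mem_erase hi]
      rw [this, if_pos (Finset.mem_insert_self j B)]
    · refine lintegral_congr fun ω => ?_
      have : observation a W n (cubeVertex k A τ B) ω = fun h =>
          ∑ i ∈ A.erase j, (if i ∈ B then τ else -τ) * eig (b k) i *
            inner ℝ (lift k (phiLp i)) h + -(τ * eig (b k) j) * inner ℝ (e j) h +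
            (√(n : ℝ))⁻¹ * W h ω := by
        ext h
        rw [observation_cubeVertex ha hak hb k τ _ hj, if_neg hjB, neg_mul τ]
      rw [this, if_neg hjB, sub_neg_eq_add]
  have hcoord : ∀ j ∈ A, (2 : ℝ≥0∞) ^ A.card * ENNReal.ofReal (Real.exp (-1) / √2 * τ ^ 2) ≤
      ∑ B ∈ A.powerset, r j B := by
    intro j hj
    conv_rhs => rw [← Finset.insert_erase hj]
    rw [Finset.sum_powerset_insert (Finset.notMem_erase j A), ← Finset.sum_add_distrib]
    refine le_trans (le_of_eq ?_) (Finset.sum_le_sum (hpair j hj))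
    rw [Finset.sum_const, Finset.card_powerset, nsmul_eq_mul,
      ← Finset.card_erase_add_one hj, pow_succ, ← ENNReal.ofReal_mul (by positivity)]
    have : Real.exp (-1) / √2 * (2 * τ ^ 2) = 2 * (Real.exp (-1) / √2 * τ ^ 2) := by ring
    rw [this, ENNReal.ofReal_mul (by norm_num : (0 : ℝ) ≤ 2), ENNReal.ofReal_ofNat]
    push_cast
    ring
  have hsum : (2 : ℝ≥0∞) ^ A.card * ENNReal.ofReal (A.card * (Real.exp (-1) / √2 * τ ^ 2)) ≤
      2 ^ A.card * R := by
    calc _ = ∑ j ∈ A, (2 : ℝ≥0∞) ^ A.card * ENNReal.ofReal (Real.exp (-1) / √2 * τ ^ 2) := by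
          rw [Finset.sum_const, nsmul_eq_mul, ENNReal.ofReal_mul (Nat.cast_nonneg _)]
          simp only [ENNReal.ofReal_natCast]
          ring
      _ ≤ ∑ j ∈ A, ∑ B ∈ A.powerset, r j B := Finset.sum_le_sum hcoord
      _ = ∑ B ∈ A.powerset, ∑ j ∈ A, r j B := Finset.sum_comm
      _ ≤ ∑ B ∈ A.powerset, R := Finset.sum_le_sum fun B hB => (hmise B).trans (hR B hB)
      _ = _ := by simp
  exact (ENNReal.mul_le_mul_iff_right (by simp) (by simp)).1 hsum

end Cube

/-- The vertices belong to the additive class if the cube fits into the ellipsoid. -/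
lemma cubeVertex_mem {w : Fin d → ℕ → ℝ≥0∞} {L : Fin d → ℝ} (k : Fin d) (A : Finset ℕ) (τ : ℝ)
    (B : Finset ℕ)
    (h : ∑ j ∈ A, w k j ^ 2 * ENNReal.ofReal (τ ^ 2) ≤ ENNReal.ofReal (L k ^ 2)) :
    cubeVertex k A τ B ∈ additiveClass fun k => ellipsoidClass (w k) (L k) := by
  classical
  refine ⟨Pi.single k (∑ j ∈ A, (if j ∈ B then τ else -τ) • phiLp j), fun l => ?_, ?_⟩
  · rcases eq_or_ne l k with rfl | hl
    · rw [Pi.single_eq_same]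
      refine sum_mem_ellipsoidClass A _ (le_trans (le_of_eq (Finset.sum_congr rfl
        fun j _ => ?_)) h)
      split_ifs <;> simp
    · rw [Pi.single_eq_of_ne hl]
      simpa using sum_mem_ellipsoidClass (w := w l) (L := L l) ∅ 0 (by simp)
  · rw [Finset.sum_eq_single k (fun l _ hl => ?_) (by simp), Pi.single_eq_same]
    · rfl
    · rw [Pi.single_eq_of_ne hl, ← liftₗᵢ_apply, map_zero]

variable [MeasurableSpace Ω] {P : Measure Ω} [IsProbabilityMeasure P]

/-- Each coordinate bounds the minimax risk from below by its own rate. -/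
theorem minimax_lower_bound {s q L : Fin d → ℝ} (k : Fin d) (hs : 0 < s k) (hq : 0 ≤ q k)
    (hL : 0 < L k) {w : Fin d → ℕ → ℝ≥0∞} {C₁ : ℝ} (hC₁ : 0 < C₁)
    (hw : ∀ j : ℕ, 1 ≤ j → w k j ≤ ENNReal.ofReal (C₁ * (j : ℝ) ^ s k))
    {a : UnitAddTorus (Fin d) → ℝ} (ha : Integrable a)
    (hak : ∀ k, MemLp (marginal a k) 2) {b : Fin d → ℕ → ℝ}
    (hb : ∀ k, HasSum (fun j => b k j • phiLp j) (hak k).toLp)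
    {C₃ : ℝ} (hC₃ : 0 < C₃)
    (hbj : ∀ j : ℕ, 1 ≤ j → 0 ≤ b k j ∧ b k j ≤ C₃ * (j : ℝ) ^ (-q k))
    (hW : IsWhiteNoise P W) :
    0 < liminf (fun n : ℕ =>
      ENNReal.ofReal ((n : ℝ) ^ (2 * s k / (2 * s k + 2 * q k + 1))) *
      ⨅ ghat : (L2Torus d → ℝ) → L2Torus d, ⨅ _ : IsEstimator ghat,
        ⨆ f ∈ additiveClass fun k => ellipsoidClass (w k) (L k), mise P a W n ghat f) atTop := by
  set D := 2 * s k + 2 * q k + 1 with hD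
  have hD0 : 0 < D := by positivity
  -- the half-width of the cube is `κ J ^ (-s - 1/2)`, with `κ` small enough for the cube to fit
  -- into the ellipsoid and for neighbouring vertices to be statistically indistinguishable
  set κ := min (1 / C₃) (L k / (C₁ * 2 ^ s k)) with hκ
  have hκ0 : 0 < κ := lt_min (by positivity) (by positivity)
  have hκ1 : κ * C₃ ≤ 1 := by
    rw [← le_div_iff₀ hC₃]; exact min_le_left _ _
  have hκ2 : κ * (C₁ * 2 ^ s k) ≤ L k := by
    rw [← le_div_iff₀ (by positivity)]; exact min_le_right _ _
  set c := Real.exp (-1) / √2 * κ ^ 2 * 2 ^ (-(2 * s k)) with hc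
  have hc0 : 0 < c := by positivity
  refine lt_of_lt_of_le (ENNReal.ofReal_pos.2 hc0) (le_liminf_of_le (h := ?_))
  filter_upwards [eventually_ge_atTop 1] with n hn
  have hn1 : (1 : ℝ) ≤ n := by exact_mod_cast hn
  have hn0 : (0 : ℝ) < n := by linarith
  set ρ : ℝ := (n : ℝ) ^ (1 / D) with hρ
  have hρ1 : 1 ≤ ρ := Real.one_le_rpow hn1 (by positivity)
  set J : ℕ := ⌈ρ⌉₊ with hJ
  have hJge : ρ ≤ J := Nat.le_ceil _
  have hJle : (J : ℝ) ≤ 2 * ρ := by linarith [Nat.ceil_lt_add_one (by linarith : 0 ≤ ρ)]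
  have hJ0 : (0 : ℝ) < J := by linarith
  set τ : ℝ := κ * (J : ℝ) ^ (-s k - 1 / 2) with hτ
  have hτ0 : 0 < τ := by positivity
  have hτsq : (J : ℝ) * τ ^ 2 = κ ^ 2 * (J : ℝ) ^ (-(2 * s k)) := by
    rw [hτ, mul_pow, ← Real.rpow_natCast ((J : ℝ) ^ _), ← Real.rpow_mul hJ0.le]
    have : (J : ℝ) * (κ ^ 2 * (J : ℝ) ^ ((-s k - 1 / 2) * (2 : ℕ))) =
        κ ^ 2 * ((J : ℝ) ^ (1 : ℝ) * (J : ℝ) ^ ((-s k - 1 / 2) * (2 : ℕ))) := by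
      rw [Real.rpow_one]; ring
    rw [this, ← Real.rpow_add hJ0]
    congr 2
    push_cast
    ring
  set A := Finset.Ioc J (2 * J) with hA
  have hAcard : A.card = J := by
    rw [hA, Nat.card_Ioc]; omega
  have hA1 : ∀ j ∈ A, 1 ≤ j ∧ (J : ℝ) ≤ j ∧ (j : ℝ) ≤ 2 * J := fun j hj => by
    obtain ⟨h1, h2⟩ := Finset.mem_Ioc.1 hj
    exact ⟨by omega, by exact_mod_cast h1.le, by exact_mod_cast h2⟩
  have heig : ∀ j ∈ A, eig (b k) j = b k j / √2 := fun j hj => by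
    rw [eig, if_neg (by have := (hA1 j hj).1; omega)]
  have hpos : ∀ j ∈ A, 0 ≤ eig (b k) j := fun j hj => by
    rw [heig j hj]
    exact div_nonneg (hbj j (hA1 j hj).1).1 (Real.sqrt_nonneg _)
  have hμ : ∀ j ∈ A, τ * eig (b k) j ≤ (√(n : ℝ))⁻¹ := fun j hj => by
    obtain ⟨hj1, hj2, -⟩ := hA1 j hj
    have h1 : eig (b k) j ≤ C₃ * (J : ℝ) ^ (-q k) := by
      rw [heig j hj]
      refine (div_le_self (hbj j hj1).1 (Real.one_le_sqrt.2 (by norm_num))).trans ?_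
      refine (hbj j hj1).2.trans (mul_le_mul_of_nonneg_left ?_ hC₃.le)
      exact Real.rpow_le_rpow_of_nonpos hJ0 hj2 (by linarith)
    calc τ * eig (b k) j ≤ κ * (J : ℝ) ^ (-s k - 1 / 2) * (C₃ * (J : ℝ) ^ (-q k)) :=
          mul_le_mul_of_nonneg_left h1 hτ0.le
      _ = κ * C₃ * (J : ℝ) ^ (-(D / 2)) := by
          have : (J : ℝ) ^ (-(D / 2)) = (J : ℝ) ^ (-s k - 1 / 2) * (J : ℝ) ^ (-q k) := by
            rw [← Real.rpow_add hJ0, hD]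
            congr 1
            ring
          rw [this]; ring
      _ ≤ 1 * ρ ^ (-(D / 2)) :=
          mul_le_mul hκ1 (Real.rpow_le_rpow_of_nonpos (by linarith) hJge (by linarith))
            (by positivity) zero_le_one
      _ = (√(n : ℝ))⁻¹ := by
          rw [one_mul, hρ, ← Real.rpow_mul hn0.le, Real.sqrt_eq_rpow, ← Real.rpow_neg hn0.le]
          congr 1
          field_simp
  have hmem : ∑ j ∈ A, w k j ^ 2 * ENNReal.ofReal (τ ^ 2) ≤ ENNReal.ofReal (L k ^ 2) := by
    have hterm : ∀ j ∈ A, w k j ^ 2 * ENNReal.ofReal (τ ^ 2) ≤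
        ENNReal.ofReal ((C₁ * (2 * J : ℝ) ^ s k) ^ 2 * τ ^ 2) := fun j hj => by
      obtain ⟨hj1, -, hj3⟩ := hA1 j hj
      rw [ENNReal.ofReal_mul (sq_nonneg _),
        ENNReal.ofReal_pow (by positivity : 0 ≤ C₁ * (2 * J : ℝ) ^ s k)]
      gcongr
      refine (hw j hj1).trans (ENNReal.ofReal_le_ofReal ?_)
      gcongr
    refine (Finset.sum_le_sum hterm).trans ?_
    rw [Finset.sum_const, hAcard, nsmul_eq_mul, ← ENNReal.ofReal_natCast,
      ← ENNReal.ofReal_mul (Nat.cast_nonneg _)]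
    refine ENNReal.ofReal_le_ofReal ?_
    have h1 : (J : ℝ) * ((C₁ * (2 * J : ℝ) ^ s k) ^ 2 * τ ^ 2) = (κ * (C₁ * 2 ^ s k)) ^ 2 := by
      have h2 : (J : ℝ) ^ (-(2 * s k)) = (((J : ℝ) ^ s k) ^ 2)⁻¹ := by
        rw [Real.rpow_neg hJ0.le, ← Real.rpow_natCast ((J : ℝ) ^ s k), ← Real.rpow_mul hJ0.le]
        congr 2
        push_cast
        ring
      have h3 : (J : ℝ) * ((C₁ * (2 * J : ℝ) ^ s k) ^ 2 * τ ^ 2) =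
          (C₁ * (2 * J : ℝ) ^ s k) ^ 2 * (J * τ ^ 2) := by ring
      rw [h3, hτsq, h2, Real.mul_rpow (by norm_num) hJ0.le]
      field_simp
    rw [h1]
    exact pow_le_pow_left₀ (by positivity) hκ2 2
  have hrisk : ENNReal.ofReal (c * (n : ℝ) ^ (-(2 * s k / D))) ≤
      ⨅ ghat : (L2Torus d → ℝ) → L2Torus d, ⨅ _ : IsEstimator ghat,
        ⨆ f ∈ additiveClass fun k => ellipsoidClass (w k) (L k), mise P a W n ghat f := by
    refine le_iInf₂ fun ghat hg => ?_
    refine le_trans (ENNReal.ofReal_le_ofReal ?_) (assouad_bound ha hak hb hW k A hτ0.le hn hpos hμ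
      hg (R := ⨆ f ∈ additiveClass fun k => ellipsoidClass (w k) (L k), mise P a W n ghat f)
      fun B _ => le_iSup₂_of_le _ (cubeVertex_mem k A τ B hmem) le_rfl)
    calc c * (n : ℝ) ^ (-(2 * s k / D)) =
          Real.exp (-1) / √2 * (κ ^ 2 * (2 * ρ) ^ (-(2 * s k))) := by
          rw [hc, Real.mul_rpow (by norm_num) (by positivity), hρ, ← Real.rpow_mul hn0.le]
          have : 1 / D * -(2 * s k) = -(2 * s k / D) := by ring
          rw [this]
          ring
      _ ≤ Real.exp (-1) / √2 * (κ ^ 2 * (J : ℝ) ^ (-(2 * s k))) := by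
          have := Real.rpow_le_rpow_of_nonpos hJ0 hJle (by linarith : -(2 * s k) ≤ 0)
          gcongr
      _ = A.card * (Real.exp (-1) / √2 * τ ^ 2) := by
          rw [← hτsq, hAcard]
          ring
  calc ENNReal.ofReal c =
        ENNReal.ofReal ((n : ℝ) ^ (2 * s k / D)) *
          ENNReal.ofReal (c * (n : ℝ) ^ (-(2 * s k / D))) := by
        rw [← ENNReal.ofReal_mul (by positivity), mul_left_comm, ← Real.rpow_add hn0,
          add_neg_cancel, Real.rpow_zero, mul_one]
    _ ≤ _ := by gcongr

end

end AdditiveInverse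

end

theorem corollary3 {d : ℕ} (hd : 0 < d)
    (s q L : Fin d → ℝ) (hs : ∀ k, 0 < s k) (hq : ∀ k, 0 ≤ q k) (hL : ∀ k, 0 < L k)
    -- the weights of the ellipsoids
    (w : Fin d → ℕ → ℝ≥0∞) (C₀ C₁ : ℝ) (hC₀ : 0 < C₀) (hC₁ : 0 < C₁)
    (hw₀ : ∀ k, 0 < w k 0)
    (hw : ∀ k, ∀ j : ℕ, 1 ≤ j → ENNReal.ofReal (C₀ * (j : ℝ) ^ s k) ≤ w k j ∧
      w k j ≤ ENNReal.ofReal (C₁ * (j : ℝ) ^ s k))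
    -- the convolution filter, its marginals and their Fourier coefficients
    (a : UnitAddTorus (Fin d) → ℝ) (ha : Integrable a)
    (hak : ∀ k, MemLp (AdditiveInverse.marginal a k) 2)
    (b : Fin d → ℕ → ℝ)
    (hb : ∀ k, HasSum (fun j => b k j • AdditiveInverse.phiLp j) (hak k).toLp)
    (C₂ C₃ : ℝ) (hC₂ : 0 < C₂) (hC₃ : 0 < C₃)
    (hb₀ : ∀ k, 0 < b k 0)
    (hbj : ∀ k, ∀ j : ℕ, 1 ≤ j →
      C₂ * (j : ℝ) ^ (-q k) ≤ b k j ∧ b k j ≤ C₃ * (j : ℝ) ^ (-q k))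
    -- the white noise
    {Ω : Type*} [MeasurableSpace Ω] (P : Measure Ω) [IsProbabilityMeasure P]
    (W : AdditiveInverse.L2Torus d → Ω → ℝ) (hW : AdditiveInverse.IsWhiteNoise P W)
    -- the function class and the exponent of the rate
    (F : Set (AdditiveInverse.L2Torus d))
    (hF : F = AdditiveInverse.additiveClass
      fun k => AdditiveInverse.ellipsoidClass (w k) (L k))
    (α : ℝ) (hα : α = ⨅ k, 2 * s k / (2 * s k + 2 * q k + 1)) :
    -- nets of the required size exist
    (∃ N : Fin d → ℝ → Set AdditiveInverse.L2One, ∀ k,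
      AdditiveInverse.IsNetFamily (s k)
        (AdditiveInverse.ellipsoidClass (w k) (L k)) (N k)) ∧
    -- and with any such nets the net estimator exists and attains the rate
    (∀ N : Fin d → ℝ → Set AdditiveInverse.L2One,
      (∀ k, AdditiveInverse.IsNetFamily (s k)
        (AdditiveInverse.ellipsoidClass (w k) (L k)) (N k)) →
      ∀ δ : Fin d → ℕ → ℝ,
        (∃ c > 0, ∃ C > 0, ∀ k, ∀ n : ℕ, 1 ≤ n →
          c * (n : ℝ) ^ (-(s k / (2 * s k + 2 * q k + 1))) ≤ δ k n ∧
          δ k n ≤ C * (n : ℝ) ^ (-(s k / (2 * s k + 2 * q k + 1)))) →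
        (∃ fhat : ℕ → (AdditiveInverse.L2Torus d → ℝ) → AdditiveInverse.L2Torus d,
          ∀ n, 1 ≤ n → AdditiveInverse.IsMinimizerOver a
            (AdditiveInverse.additiveClass fun k => N k (δ k n)) (fhat n)) ∧
        ∀ fhat : ℕ → (AdditiveInverse.L2Torus d → ℝ) → AdditiveInverse.L2Torus d,
          (∀ n, 1 ≤ n → AdditiveInverse.IsMinimizerOver a
            (AdditiveInverse.additiveClass fun k => N k (δ k n)) (fhat n)) →
          limsup (fun n : ℕ => ENNReal.ofReal ((n : ℝ) ^ α) *
            ⨆ f ∈ F, AdditiveInverse.mise P a W n (fhat n) f) atTop < ⊤) ∧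
    -- the minimax lower bound
    0 < liminf (fun n : ℕ => ENNReal.ofReal ((n : ℝ) ^ α) *
      ⨅ ghat : (AdditiveInverse.L2Torus d → ℝ) → AdditiveInverse.L2Torus d,
        ⨅ _ : AdditiveInverse.IsEstimator ghat,
          ⨆ f ∈ F, AdditiveInverse.mise P a W n ghat f) atTop := by
  subst hF
  have hα_le : ∀ k, α ≤ 2 * s k / (2 * s k + 2 * q k + 1) := fun k => by
    rw [hα]
    exact ciInf_le (Set.finite_range _).bddBelow k
  refine ⟨?_, fun N hN δ hδ => ?_, ?_⟩
  · have h : ∀ k, ∃ N, AdditiveInverse.IsNetFamily (s k)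
        (AdditiveInverse.ellipsoidClass (w k) (L k)) N := fun k => by
      obtain ⟨c, hc, hwc⟩ := AdditiveInverse.exists_weight_lower_bound hC₀ (hw₀ k)
        fun j hj => (hw k j hj).1
      exact AdditiveInverse.exists_isNetFamily hc hwc (hs k) (hL k)
    choose N hN using h
    exact ⟨N, hN⟩
  · exact AdditiveInverse.net_estimator_rate ⟨0, hd⟩ hs hq w ha hak hb hC₂ hb₀
      (fun k j hj => (hbj k j hj).1) hW hα_le hN hδ
  · have : Nonempty (Fin d) := ⟨⟨0, hd⟩⟩
    obtain ⟨k, hk⟩ := exists_eq_ciInf_of_finite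
      (f := fun k => 2 * s k / (2 * s k + 2 * q k + 1))
    rw [hα, ← hk]
    exact AdditiveInverse.minimax_lower_bound k (hs k) (hq k) (hL k) hC₁
      (fun j hj => (hw k j hj).2) ha hak hb hC₃
      (fun j hj => ⟨le_trans (by positivity) (hbj k j hj).1, (hbj k j hj).2⟩) hW
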